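/- Let $m\ge 0$, $N=2^m$, and let $\mathbb F_2^{2m}$ carry the symplectic form $\langle a,b\rangle=\sum_{j=1}^m(a_jb_{m+j}+a_{m+j}b_j)$; write $\mathbb F_*^{2m}=\mathbb F_2^{2m}\setminus\{0\}$. For $a\in\mathbb F_2^{2m}$ let $E(a)=i^{a_X\cdot a_Z}X_1^{a_1}\cdots X_m^{a_m}Z_1^{a_{m+1}}\cdots Z_m^{a_{2m}}$ be the Hermitian $m$-qubit Pauli operator, where $a_X\cdot a_Z=\sum_{j=1}^m a_ja_{m+j}$ is computed in $\mathbb Z$. The Clifford group $\mathcal C_m$ consists of the unitaries $U\in U(N)$ such that for every $a$ one has $UE(a)U^\dagger=\pm E(b)$ for some $b$; it acts on $\mathcal B((\mathbb C^N)^{\otimes t})$ by $X\mapsto U^{\otimes t}X(U^\dagger)^{\otimes t}$ (the $t$-copy adjoint representation). "Invariant", "irreducible" and "equivalent" refer to this action, and orthogonality refers to the inner product $\operatorname{tr}(A^\dagger B)$. For $t=2$ put $|a,a\rangle=N^{-1}E(a)\otimes E(a)$. For $t=3$ let $|a_1,a_2,a_3\rangle$ be $N^{-3/2}E(a_1)\otimes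 E(a_2)\otimes E(a_3)$ if $a_1+a_2+a_3\ne0$, and $N^{-3/2}\,i^{y}\,E(a_1)\otimes E(a_2)\otimes E(a_1)E(a_2)$ if $a_1+a_2+a_3=0$, where $y\in\{0,1\}$ and $y\equiv\langle a_1,a_2\rangle \pmod 2$. These vectors form an orthonormal basis of $\mathcal B((\mathbb C^N)^{\otimes 3})$. For $\sigma\in S_3$ let $W_\sigma$ be the linear map with $W_\sigma|a_1,a_2,a_3\rangle=|a_{\sigma^{-1}(1)},a_{\sigma^{-1}(2)},a_{\sigma^{-1}(3)}\rangle$. The maps $$\mathcal P_S=\tfrac13\big(\mathbb 1+W_{(123)}+W_{(132)}\big),\qquad \mathcal P_1=\tfrac13\big(2\,\mathbb 1-W_{(123)}-W_{(132)}\big)$$ are orthogonal projectors. For $a\in\mathbb F_*^{2m}$ and $b\in\mathbb F_2^{2m}$ with $\langle a,b\rangle=0$ put $$|\hat a;b\rangle=\frac{\sqrt2}{N}\sum_{h:\langle a,h\rangle=1}(-1)^{\langle h,b\rangle}|a,h,a+h\rangle,\qquad |\hat a\rangle=|\hat a;0\rangle ,$$ so that $|\hat a;b\rangle=-|\hat a;a+b\rangle$,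 and for $a\in\mathbb F_*^{2m}$ put $|A(a)\rangle=\sum_{h:\langle h,a\rangle=0,\,h\ne0,a}|\hat h;a\rangle$. Let $\Lambda_\pm$ be the set of all $\lambda:\mathbb F_*^{2m}\to\mathbb C$ with $\sum_x\lambda_x=0$ and $\sum_{y\in\mathbb F_*^{2m},\,\langle y,x\rangle=0}\lambda_y=\pm\frac N2\lambda_x$ for all $x\in\mathbb F_*^{2m}$. Define - $V_d^{(\mathrm{nc})}=\mathrm{span}\{|\hat a\rangle: a\in\mathbb F_*^{2m}\}$; - $V_1^{(\mathrm{nc})}=\mathrm{span}\{\sum_x\lambda_x|A(x)\rangle:\lambda\in\Lambda_+\}$ and $V_2^{(\mathrm{nc})}=\mathrm{span}\{\sum_x\lambda_x|A(x)\rangle:\lambda\in\Lambda_-\}$; - $V^{(\mathrm{nc})}_{\mathrm{null},S}$ and $V^{(\mathrm{nc})}_{\mathrm{null},1}$, the spans of the vectors $\mathcal P\big(|\hat a;b\rangle+|\hat b;a+b\rangle+|\widehat{a+b};a\rangle\big)$, over all $a,b\in\mathbb F_*^{2m}$ with $a\ne b$ and $\langle a,b\rangle=0$, for $\mathcal P=\mathcal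 P_S$ and $\mathcal P=\mathcal P_1$ respectively. All five subspaces lie in $\mathcal S=\mathrm{span}\{|a,b,a+b\rangle+|a,a+b,b\rangle:\langle a,b\rangle=1\}$, which is contained in $\mathrm{span}\{|a,b,a+b\rangle: a,b\in\mathbb F_*^{2m},\ \langle a,b\rangle=1\}$. Moreover: (i) $V_d^{(\mathrm{nc})}$ and the two-copy diagonal sector $\mathrm{span}\{|a,a\rangle:a\in\mathbb F_*^{2m}\}$ are invariant, and $|a,a\rangle\mapsto|\hat a\rangle$ $(a\in\mathbb F_*^{2m})$ defines an invertible intertwiner from the diagonal sector onto $V_d^{(\mathrm{nc})}$. If $m\ge2$, then $V_d^{(\mathrm{nc})}$ is the direct sum of three pairwise inequivalent irreducible subrepresentations, namely $\mathrm{span}\{\sum_a|\hat a\rangle\}$ and $\mathrm{span}\{\sum_a\lambda_a|\hat a\rangle:\lambda\in\Lambda_\pm\}$. (ii) $V_1^{(\mathrm{nc})}$ and $V_2^{(\mathrm{nc})}$ are invariant. If $m\ge2$, they carry representations equivalent to those carried by the invariant subspaces $V_1=\mathrm{span}\{\sum_a\lambda_a|a,a\rangle:\lambda\in\Lambda_+\}$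 and $V_2=\mathrm{span}\{\sum_a\lambda_a|a,a\rangle:\lambda\in\Lambda_-\}$ of the two-copy diagonal sector, respectively. (iii) $V^{(\mathrm{nc})}_{\mathrm{null},S}$ is invariant. (iv) $V^{(\mathrm{nc})}_{\mathrm{null},1}$ is invariant. (v) The subspaces $V_d^{(\mathrm{nc})}$, $V^{(\mathrm{nc})}_{\mathrm{null},S}$, $V^{(\mathrm{nc})}_{\mathrm{null},1}$, $V_1^{(\mathrm{nc})}$, $V_2^{(\mathrm{nc})}$ are pairwise orthogonal, and $$\mathcal S\cap\big(V_d^{(\mathrm{nc})}\oplus V^{(\mathrm{nc})}_{\mathrm{null},S}\oplus V^{(\mathrm{nc})}_{\mathrm{null},1}\oplus V_1^{(\mathrm{nc})}\oplus V_2^{(\mathrm{nc})}\big)^\perp$$ is invariant. -/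

import Mathlib

namespace CliffordCopies

noncomputable section

open Matrix

/-- Labels of the computational basis of `m` qubits. -/
abbrev Bits (m : ℕ) : Type := Fin m → Fin 2

/-- `𝔽₂^{2m}`, written as `𝔽₂^m ⊕ 𝔽₂^m` (first the `X`-part, then the `Z`-part). -/
abbrev Label (m : ℕ) : Type := Fin m ⊕ Fin m → ZMod 2

/-- The nonzero labels. -/
abbrev NZLabel (m : ℕ) : Type := {a : Label m // a ≠ 0}

/-- The symplectic form `⟨a, b⟩ = aᵀ Ω b` on `𝔽₂^{2m}`, with `Ω` the block matrix
with zero diagonal blocks and identity off-diagonal blocks. -/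
def symp {m : ℕ} (a b : Label m) : ZMod 2 :=
  ∑ j : Fin m, (a (Sum.inl j) * b (Sum.inr j) + a (Sum.inr j) * b (Sum.inl j))

/-- Tensor (Kronecker) product of a finite family of square matrices of the same size. -/
def tensor {ι n : Type*} [Fintype ι] (A : ι → Matrix n n ℂ) : Matrix (ι → n) (ι → n) ℂ :=
  Matrix.of fun i j => ∏ k, A k (i k) (j k)

theorem tensor_mul {ι n : Type*} [Fintype ι] [DecidableEq ι] [Fintype n]
    (A B : ι → Matrix n n ℂ) : tensor A * tensor B = tensor fun k => A k * B k := by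
  ext i j
  simp only [tensor, Matrix.mul_apply, Matrix.of_apply, Finset.prod_univ_sum,
    Fintype.piFinset_univ, Finset.prod_mul_distrib]

theorem tensor_one {ι n : Type*} [Fintype ι] [DecidableEq n] [DecidableEq (ι → n)] :
    tensor (fun _ : ι => (1 : Matrix n n ℂ)) = 1 := by
  ext i j
  by_cases h : i = j
  · subst h
    simp [tensor]
  · obtain ⟨k, hk⟩ := Function.ne_iff.mp h
    rw [Matrix.one_apply_ne h]
    exact Finset.prod_eq_zero (Finset.mem_univ k) (Matrix.one_apply_ne hk)

def pauliX : Matrix (Fin 2) (Fin 2) ℂ := !![0, 1; 1, 0]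

def pauliZ : Matrix (Fin 2) (Fin 2) ℂ := !![1, 0; 0, -1]

/-- The Hermitian Pauli operator `E(a) = i^{a_X · a_Z} X(a_X) Z(a_Z)` on `m` qubits, where
`a_X · a_Z` is computed in the integers. -/
def pauli {m : ℕ} (a : Label m) : Matrix (Bits m) (Bits m) ℂ :=
  Complex.I ^ (∑ j : Fin m, (a (Sum.inl j)).val * (a (Sum.inr j)).val) •
    (tensor (fun j : Fin m => pauliX ^ (a (Sum.inl j)).val) *
      tensor (fun j : Fin m => pauliZ ^ (a (Sum.inr j)).val))

/-- The operators `± E(a)`. -/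
def signedPaulis (m : ℕ) : Set (Matrix (Bits m) (Bits m) ℂ) :=
  {P | ∃ a : Label m, P = pauli a ∨ P = -pauli a}

theorem signedPaulis_finite (m : ℕ) : (signedPaulis m).Finite := by
  have h : signedPaulis m =
      Set.range (pauli (m := m)) ∪ Set.range (fun a : Label m => -pauli a) := by
    ext P
    constructor
    · rintro ⟨a, h | h⟩
      · exact Or.inl ⟨a, h.symm⟩
      · exact Or.inr ⟨a, h.symm⟩
    · rintro (⟨a, h⟩ | ⟨a, h⟩)
      · exact ⟨a, Or.inl h.symm⟩
      · exact ⟨a, Or.inr h.symm⟩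
  rw [h]
  exact (Set.finite_range _).union (Set.finite_range _)

theorem neg_mem_signedPaulis {m : ℕ} {P : Matrix (Bits m) (Bits m) ℂ}
    (h : P ∈ signedPaulis m) : -P ∈ signedPaulis m := by
  obtain ⟨a, rfl | rfl⟩ := h
  · exact ⟨a, Or.inr rfl⟩
  · exact ⟨a, Or.inl (neg_neg _)⟩

theorem conj_mem_signedPaulis {m : ℕ} {U : Matrix (Bits m) (Bits m) ℂ}
    (hU : ∀ a : Label m, U * pauli a * Uᴴ ∈ signedPaulis m)
    {P : Matrix (Bits m) (Bits m) ℂ} (hP : P ∈ signedPaulis m) :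
    U * P * Uᴴ ∈ signedPaulis m := by
  obtain ⟨a, rfl | rfl⟩ := hP
  · exact hU a
  · have h := neg_mem_signedPaulis (hU a)
    simpa [Matrix.mul_neg, Matrix.neg_mul] using h

/-- The `m`-qubit Clifford group: the unitaries `U` such that for every Pauli operator `E(a)`
the operator `U E(a) U†` is `± E(b)` for some `b`. -/
def cliffordGroup (m : ℕ) : Subgroup (Matrix.unitaryGroup (Bits m) ℂ) where
  carrier := {U | ∀ a : Label m, (U : Matrix (Bits m) (Bits m) ℂ) * pauli a *
    (U : Matrix (Bits m) (Bits m) ℂ)ᴴ ∈ signedPaulis m}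
  one_mem' := fun a => ⟨a, Or.inl (by simp)⟩
  mul_mem' := by
    intro U V hU hV a
    have h := conj_mem_signedPaulis hU (hV a)
    simpa [Matrix.conjTranspose_mul, Matrix.mul_assoc] using h
  inv_mem' := by
    intro U hU a
    have h1 : (U : Matrix (Bits m) (Bits m) ℂ)ᴴ * (U : Matrix (Bits m) (Bits m) ℂ) = 1 :=
      Matrix.UnitaryGroup.star_mul_self U
    have key : ∀ P : Matrix (Bits m) (Bits m) ℂ,
        (U : Matrix (Bits m) (Bits m) ℂ)ᴴ * ((U : Matrix (Bits m) (Bits m) ℂ) * P *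
          (U : Matrix (Bits m) (Bits m) ℂ)ᴴ) * (U : Matrix (Bits m) (Bits m) ℂ) = P := by
      intro P
      calc _ = ((U : Matrix (Bits m) (Bits m) ℂ)ᴴ * (U : Matrix (Bits m) (Bits m) ℂ)) * P *
            ((U : Matrix (Bits m) (Bits m) ℂ)ᴴ * (U : Matrix (Bits m) (Bits m) ℂ)) := by
              simp only [Matrix.mul_assoc]
        _ = P := by simp [h1]
    have hmaps : Set.MapsTo (fun P => (U : Matrix (Bits m) (Bits m) ℂ) * P *
        (U : Matrix (Bits m) (Bits m) ℂ)ᴴ) (signedPaulis m) (signedPaulis m) :=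
      fun P hP => conj_mem_signedPaulis hU hP
    have hinj : Set.InjOn (fun P => (U : Matrix (Bits m) (Bits m) ℂ) * P *
        (U : Matrix (Bits m) (Bits m) ℂ)ᴴ) (signedPaulis m) := by
      intro P _ Q _ h
      have h' := congrArg (fun R => (U : Matrix (Bits m) (Bits m) ℂ)ᴴ * R *
        (U : Matrix (Bits m) (Bits m) ℂ)) h
      simpa only [key] using h'
    obtain ⟨P, hP, hPa⟩ := (((signedPaulis_finite m).injOn_iff_bijOn_of_mapsTo hmaps).mp hinj).surjOn
      (⟨a, Or.inl rfl⟩ : pauli a ∈ signedPaulis m)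
    have h2 : ((U⁻¹ : Matrix.unitaryGroup (Bits m) ℂ) : Matrix (Bits m) (Bits m) ℂ) =
        (U : Matrix (Bits m) (Bits m) ℂ)ᴴ := rfl
    have h3 : (U : Matrix (Bits m) (Bits m) ℂ)ᴴ * pauli a *
        (U : Matrix (Bits m) (Bits m) ℂ) = P := by
      rw [← hPa]
      exact key P
    rw [h2, Matrix.conjTranspose_conjTranspose, h3]
    exact hP

/-- The operators on `t` copies of an `m`-qubit system. -/
abbrev Op (m t : ℕ) : Type := Matrix (Fin t → Bits m) (Fin t → Bits m) ℂ

theorem tensor_conjTranspose {ι n : Type*} [Fintype ι] (A : ι → Matrix n n ℂ) :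
    (tensor A)ᴴ = tensor fun k => (A k)ᴴ := by
  ext i j
  simp [tensor, Matrix.conjTranspose_apply]

/-- The `t`-copy adjoint representation `X ↦ U^{⊗t} X (U†)^{⊗t}` of the Clifford group. -/
def adjointRep (m t : ℕ) : Representation ℂ (cliffordGroup m) (Op m t) where
  toFun g :=
    LinearMap.mulLeft ℂ (tensor fun _ : Fin t => (g.1 : Matrix (Bits m) (Bits m) ℂ)) ∘ₗ
      LinearMap.mulRight ℂ (tensor fun _ : Fin t => (g.1 : Matrix (Bits m) (Bits m) ℂ)ᴴ)
  map_one' := by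
    ext1 X
    simp [tensor_one]
  map_mul' g h := by
    ext1 X
    simp [← tensor_mul, Matrix.mul_assoc]

/-- The Frobenius inner product `⟨A|B⟩ = tr (A† B)`, antilinear in the first argument. -/
def frob (m t : ℕ) : Op m t →ₗ⋆[ℂ] Op m t →ₗ[ℂ] ℂ :=
  LinearMap.mk₂'ₛₗ (starRingEnd ℂ) (RingHom.id ℂ) (fun A B => (Aᴴ * B).trace)
    (fun A A' B => by simp [Matrix.conjTranspose_add, Matrix.add_mul])
    (fun c A B => by simp [Matrix.conjTranspose_smul])
    (fun A B B' => by simp [Matrix.mul_add])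
    (fun c A B => by simp)

/-- The two-copy Pauli vector `|a,a⟩ = N⁻¹ E(a) ⊗ E(a)`, `N = 2^m`. -/
def ket₂ {m : ℕ} (a : Label m) : Op m 2 :=
  ((2 : ℂ) ^ m)⁻¹ • tensor fun _ : Fin 2 => pauli a

/-- The three-copy Pauli basis `|a₁,a₂,a₃⟩`, `N = 2^m`. If `a₁ + a₂ + a₃ = 0`, the phase of
`E(a₁) ⊗ E(a₂) ⊗ E(a₃)` is chosen such that the basis vector is
`N^{-3/2} i^y E(a₁) ⊗ E(a₂) ⊗ E(a₁)E(a₂)`, where `y = 1` if `⟨a₁,a₂⟩ = 1` (this makes the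
operator Hermitian) and `y = 0` otherwise. -/
def ket₃ {m : ℕ} (a : Fin 3 → Label m) : Op m 3 :=
  (((Real.sqrt (((2 : ℝ) ^ m) ^ 3))⁻¹ : ℝ) : ℂ) •
    if a 0 + a 1 + a 2 = 0 then
      Complex.I ^ (symp (a 0) (a 1)).val •
        tensor ![pauli (a 0), pauli (a 1), pauli (a 0) * pauli (a 1)]
    else tensor fun k => pauli (a k)

/-- The linear map `W_σ` with `W_σ |a₁,a₂,a₃⟩ = |a_{σ⁻¹(1)},a_{σ⁻¹(2)},a_{σ⁻¹(3)}⟩`, given by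
expanding an operator in the orthonormal basis `ket₃`. -/
def permW (m : ℕ) (σ : Equiv.Perm (Fin 3)) : Op m 3 →ₗ[ℂ] Op m 3 :=
  ∑ a : Fin 3 → Label m, (frob m 3 (ket₃ a)).smulRight (ket₃ (a ∘ ⇑σ⁻¹))

/-- The vector `|â;b⟩` (used for `a ≠ 0` and `⟨a,b⟩ = 0`). -/
def hatKet {m : ℕ} (a b : Label m) : Op m 3 :=
  ((Real.sqrt 2 / 2 ^ m : ℝ) : ℂ) •
    ∑ h : Label m with symp a h = 1, (-1 : ℂ) ^ (symp h b).val • ket₃ ![a, h, a + h]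

/-- The vector `|A(a)⟩`. -/
def ketA {m : ℕ} (a : Label m) : Op m 3 :=
  ∑ h : Label m with symp h a = 0 ∧ h ≠ a ∧ h ≠ 0, hatKet h a

/-- The coefficient families `(λ_x)` over nonzero labels with `∑ λ_x = 0` and
`∑_{y : ⟨y,x⟩ = 0} λ_y = s (N/2) λ_x` for all `x` (used for `s = 1` and `s = -1`). -/
def IsCoeff {m : ℕ} (s : ℂ) (l : NZLabel m → ℂ) : Prop :=
  ∑ x, l x = 0 ∧
    ∀ x : NZLabel m, ∑ y : NZLabel m with symp y.1 x.1 = 0, l y = s * ((2 : ℂ) ^ m / 2) * l x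

/-- The span of all `∑_x λ_x v_x` with coefficients as in `IsCoeff s`. -/
def eigSpan {m t : ℕ} (s : ℂ) (v : Label m → Op m t) : Submodule ℂ (Op m t) :=
  Submodule.span ℂ {X | ∃ l : NZLabel m → ℂ, IsCoeff s l ∧ X = ∑ x, l x • v x.1}

/-- The line spanned by `∑_x v_x`. -/
def sumLine {m t : ℕ} (v : Label m → Op m t) : Submodule ℂ (Op m t) :=
  Submodule.span ℂ {∑ x : NZLabel m, v x.1}

/-- The span of all `|a,b,a+b⟩` with `⟨a,b⟩ = 1`. -/
def ncSpace (m : ℕ) : Submodule ℂ (Op m 3) :=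
  Submodule.span ℂ {X | ∃ a b : Label m, a ≠ 0 ∧ b ≠ 0 ∧ symp a b = 1 ∧ X = ket₃ ![a, b, a + b]}

/-- The span of all `|a,b,a+b⟩ + |a,a+b,b⟩` with `⟨a,b⟩ = 1`. -/
def ncSymSpace (m : ℕ) : Submodule ℂ (Op m 3) :=
  Submodule.span ℂ
    {X | ∃ a b : Label m, symp a b = 1 ∧ X = ket₃ ![a, b, a + b] + ket₃ ![a, a + b, b]}

/-- The two-copy diagonal sector. -/
def diagSector (m : ℕ) : Submodule ℂ (Op m 2) :=
  Submodule.span ℂ {X | ∃ a : Label m, a ≠ 0 ∧ X = ket₂ a}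

/-- The subspace `V₁` of the two-copy diagonal sector. -/
def diagV₁ (m : ℕ) : Submodule ℂ (Op m 2) := eigSpan 1 ket₂

/-- The subspace `V₂` of the two-copy diagonal sector. -/
def diagV₂ (m : ℕ) : Submodule ℂ (Op m 2) := eigSpan (-1) ket₂

def ncVd (m : ℕ) : Submodule ℂ (Op m 3) :=
  Submodule.span ℂ {X | ∃ a : Label m, a ≠ 0 ∧ X = hatKet a 0}

/-- The three parts of `ncVd`: the sum line and the two spans with signs `+` and `-`. -/
def ncVdPart (m : ℕ) : Fin 3 → Submodule ℂ (Op m 3) :=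
  ![sumLine fun a => hatKet a 0, eigSpan 1 fun a => hatKet a 0, eigSpan (-1) fun a => hatKet a 0]

def ncV₁ (m : ℕ) : Submodule ℂ (Op m 3) := eigSpan 1 ketA

def ncV₂ (m : ℕ) : Submodule ℂ (Op m 3) := eigSpan (-1) ketA

/-- `W_{(123)} + W_{(132)}`; the cycle `(123)` is `finRotate 3`. -/
def cycSum (m : ℕ) : Op m 3 →ₗ[ℂ] Op m 3 := permW m (finRotate 3) + permW m (finRotate 3)⁻¹

def projS (m : ℕ) : Op m 3 →ₗ[ℂ] Op m 3 := (1 / 3 : ℂ) • (LinearMap.id + cycSum m)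

def projOne (m : ℕ) : Op m 3 →ₗ[ℂ] Op m 3 := (1 / 3 : ℂ) • ((2 : ℂ) • LinearMap.id - cycSum m)

/-- The span of `P (|â;b⟩ + |b̂;a+b⟩ + |(a+b)^;a⟩)` for nonzero `a ≠ b` with `⟨a,b⟩ = 0`. -/
def ncNull {m : ℕ} (P : Op m 3 →ₗ[ℂ] Op m 3) : Submodule ℂ (Op m 3) :=
  Submodule.span ℂ {X | ∃ a b : Label m, a ≠ 0 ∧ b ≠ 0 ∧ a ≠ b ∧ symp a b = 0 ∧
    X = P (hatKet a b + hatKet b (a + b) + hatKet (a + b) a)}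

def ncNullS (m : ℕ) : Submodule ℂ (Op m 3) := ncNull (projS m)

def ncNullOne (m : ℕ) : Submodule ℂ (Op m 3) := ncNull (projOne m)

/-- The five subspaces `V_d`, `V_{null,S}`, `V_{null,1}`, `V₁`, `V₂` of the three-copy space. -/
def ncFamily (m : ℕ) : Fin 5 → Submodule ℂ (Op m 3) :=
  ![ncVd m, ncNullS m, ncNullOne m, ncV₁ m, ncV₂ m]

/-- The remaining orthogonal complement inside `ncSymSpace`. -/
def ncRest (m : ℕ) : Submodule ℂ (Op m 3) :=
  ncSymSpace m ⊓
    (⨆ i, ncFamily m i).orthogonalBilin (frob m 3)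

/-- `W` is invariant under the `t`-copy adjoint representation of the Clifford group. -/
def IsInv {m t : ℕ} (W : Submodule ℂ (Op m t)) : Prop :=
  ∀ g : cliffordGroup m, W ≤ W.comap (adjointRep m t g)

/-- The subrepresentation carried by an invariant subspace. -/
abbrev subrep {m t : ℕ} {W : Submodule ℂ (Op m t)} (hW : IsInv W) :
    Representation ℂ (cliffordGroup m) W :=
  (adjointRep m t).subrepresentation W hW

/-- Both subspaces are invariant and carry equivalent representations of the Clifford group. -/
def EquivalentReps {m t t' : ℕ} (W : Submodule ℂ (Op m t)) (W' : Submodule ℂ (Op m t')) : Prop :=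
  ∃ (hW : IsInv W) (hW' : IsInv W'), Nonempty ((subrep hW).Equiv (subrep hW'))

/-- The subspace is invariant and carries an irreducible representation. -/
def CarriesIrrep {m t : ℕ} (W : Submodule ℂ (Op m t)) : Prop :=
  ∃ hW : IsInv W, (subrep hW).IsIrreducible

end

end CliffordCopies

open CliffordCopies

namespace CliffordCopies

noncomputable section

open Matrix

/-! A Clifford unitary sends `E(a)` to `± E(b)`, and `a ↦ b` is an additive bijection preserving the
symplectic form. On the vectors used here the signs cancel: in `|a,a⟩` the sign is squared, and in
`|a,b,a+b⟩` the third factor is the product `E(a)E(b)`, so each sign again occurs twice. Hence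
`|a,a⟩`, `|â⟩` and `|A(a)⟩` are permuted exactly as their labels are, and `λ ↦ ∑ λ_x v_x` (`comb`)
intertwines the permutation representation on functions on nonzero labels with the operator space.
Statements (i) and (ii) are thereby reduced to that permutation representation and to injectivity of
`comb`.

The unitaries `(1 + iE(v))/√2` induce all symplectic transvections, and these have three kinds of
orbits on pairs of nonzero labels: equal, distinct orthogonal, non-orthogonal. So every equivariant
endomorphism is a combination of the identity, the orthogonality operator `perpOp` and the sum
(`exists_coeffs_of_commute`), and acts as a scalar where `perpOp` and the sum do
(`IsEig.exists_scalar`). Applied to orthogonal projections this gives irreducibility, and applied to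
extended intertwiners it gives inequivalence. On zero-sum functions `perpOp² = N²/4`
(`perpOp_perpOp`), so the constituents are the constants and `Λ_±`.

The `|â⟩` are orthonormal. The Gram matrix of the `|A(x)⟩` is `(N²/2 - 1) - perpOp`
(`frob_ketA_ketA`), a scalar on each `Λ_±`, nonzero for `m ≥ 2`.

Orthogonality in (v) rests on character sums. A null vector and its cyclic sum are orthogonal to
every `|ĉ⟩` and `|A(x)⟩`; both projectors are combinations of the identity and the cyclic sum, and
their product is zero; `Λ_+` and `Λ_-` are orthogonal because `perpOp` is symmetric. Invariance of
the complement follows from unitarity. -/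

/-- The sign character `x ↦ (-1)^x` of `𝔽₂`. -/
def sgn (x : ZMod 2) : ℂ := (-1) ^ x.val

theorem zmod_two_cases (x : ZMod 2) : x = 0 ∨ x = 1 := by
  revert x; decide

@[simp] theorem sgn_zero : sgn 0 = 1 := by simp [sgn]

@[simp] theorem sgn_one : sgn 1 = -1 := by
  have : (1 : ZMod 2).val = 1 := rfl
  simp [sgn, this]

theorem sgn_add (x y : ZMod 2) : sgn (x + y) = sgn x * sgn y := by
  have h : (1 : ZMod 2) + 1 = 0 := by decide
  rcases zmod_two_cases x with rfl | rfl <;> rcases zmod_two_cases y with rfl | rfl <;> simp [h]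

@[simp] theorem star_sgn (x : ZMod 2) : (starRingEnd ℂ) (sgn x) = sgn x := by
  simp [sgn]

theorem sgn_mul_self (x : ZMod 2) : sgn x * sgn x = 1 := by
  rcases zmod_two_cases x with rfl | rfl <;> simp

theorem ite_eq_one_sgn (x : ZMod 2) : (if x = 1 then (1 : ℂ) else 0) = (1 - sgn x) / 2 := by
  rcases zmod_two_cases x with rfl | rfl <;> norm_num

theorem ite_eq_zero_sgn (x : ZMod 2) : (if x = 0 then (1 : ℂ) else 0) = (1 + sgn x) / 2 := by
  rcases zmod_two_cases x with rfl | rfl <;> norm_num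

/-! ### The symplectic space of labels and its characters -/

variable {m : ℕ}

theorem label_add_self (a : Label m) : a + a = 0 := by
  funext j; exact CharTwo.add_self_eq_zero (a j)

theorem label_neg (a : Label m) : -a = a := neg_eq_of_add_eq_zero_left (label_add_self a)

theorem label_add_cancel (a b : Label m) : a + (a + b) = b := by
  rw [← add_assoc, label_add_self, zero_add]

theorem label_add_eq_zero {a b : Label m} : a + b = 0 ↔ a = b := by
  rw [add_eq_zero_iff_eq_neg, label_neg]

theorem label_add_eq_iff {a b c : Label m} : a + b = c ↔ b = a + c := by
  constructor
  · rintro rfl; rw [label_add_cancel]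
  · rintro rfl; rw [label_add_cancel]

theorem symp_add_left (a b c : Label m) : symp (a + b) c = symp a c + symp b c := by
  simp only [symp, ← Finset.sum_add_distrib, Pi.add_apply]
  exact Finset.sum_congr rfl fun _ _ => by ring

theorem symp_add_right (a b c : Label m) : symp a (b + c) = symp a b + symp a c := by
  simp only [symp, ← Finset.sum_add_distrib, Pi.add_apply]
  exact Finset.sum_congr rfl fun _ _ => by ring

theorem symp_comm (a b : Label m) : symp a b = symp b a := by
  simp only [symp]
  exact Finset.sum_congr rfl fun _ _ => by ring

@[simp] theorem symp_self (a : Label m) : symp a a = 0 := by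
  simp only [symp]
  refine Finset.sum_eq_zero fun j _ => ?_
  rw [mul_comm]
  exact CharTwo.add_self_eq_zero _

@[simp] theorem symp_zero_left (a : Label m) : symp 0 a = 0 := by simp [symp]

@[simp] theorem symp_zero_right (a : Label m) : symp a 0 = 0 := by simp [symp]

theorem exists_symp_eq_one {a : Label m} (ha : a ≠ 0) : ∃ z, symp a z = 1 := by
  obtain ⟨j, hj⟩ := Function.ne_iff.mp ha
  have hj' : a j = 1 := (zmod_two_cases (a j)).resolve_left hj
  rcases j with j | j
  · exact ⟨Pi.single (Sum.inr j) 1, by simp [symp, Pi.single_apply, hj']⟩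
  · exact ⟨Pi.single (Sum.inl j) 1, by simp [symp, Pi.single_apply, hj']⟩

theorem one_add_one_zmod_two : (1 : ZMod 2) + 1 = 0 := by decide

/-- A linear form is not determined by another one unless they are proportional. -/
theorem exists_symp_zero_one {x y : Label m} (hy : y ≠ 0) (hxy : y ≠ x) :
    ∃ z, symp x z = 0 ∧ symp y z = 1 := by
  obtain ⟨z₁, h₁⟩ := exists_symp_eq_one hy
  obtain ⟨z₂, h₂⟩ := exists_symp_eq_one (a := x + y)
    (fun h => hxy (label_add_eq_zero.mp h).symm)
  rw [symp_add_left] at h₂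
  rcases zmod_two_cases (symp x z₁) with hx₁ | hx₁
  · exact ⟨z₁, hx₁, h₁⟩
  rcases zmod_two_cases (symp x z₂) with hx₂ | hx₂
  · exact ⟨z₂, hx₂, by simpa [hx₂] using h₂⟩
  · have hy₂ : symp y z₂ = 0 := by simpa [hx₂] using h₂
    exact ⟨z₁ + z₂, by simp [symp_add_right, hx₁, hx₂, one_add_one_zmod_two],
      by simp [symp_add_right, h₁, hy₂]⟩

/-- Take one witness for `y` and one for `y'`; if neither serves both, their sum does. The resulting
`z` is the intermediate point of the transitivity arguments, because a single transvection joins two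
labels with symplectic product one. -/
theorem exists_symp_zero_one_one {x y y' : Label m} (hy : y ≠ 0) (hxy : y ≠ x)
    (hy' : y' ≠ 0) (hxy' : y' ≠ x) : ∃ z, symp x z = 0 ∧ symp y z = 1 ∧ symp y' z = 1 := by
  obtain ⟨z₁, h₁, k₁⟩ := exists_symp_zero_one hy hxy
  obtain ⟨z₂, h₂, k₂⟩ := exists_symp_zero_one hy' hxy'
  rcases zmod_two_cases (symp y' z₁) with e₁ | e₁
  · rcases zmod_two_cases (symp y z₂) with e₂ | e₂
    · exact ⟨z₁ + z₂, by simp [symp_add_right, *]⟩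
    · exact ⟨z₂, h₂, e₂, k₂⟩
  · exact ⟨z₁, h₁, k₁, e₁⟩

/-- The hypotheses say that `x` lies outside the span of `u` and `u'`, so its linear form is
independent of theirs. -/
theorem exists_symp_zero_zero_one {u u' x : Label m} (h0 : x ≠ 0) (hu : x ≠ u) (hu' : x ≠ u')
    (huu : x ≠ u' + u) : ∃ z, symp u z = 0 ∧ symp u' z = 0 ∧ symp x z = 1 := by
  obtain ⟨z₁, h₁, k₁⟩ := exists_symp_zero_one h0 hu
  rcases zmod_two_cases (symp u' z₁) with e₁ | e₁
  · exact ⟨z₁, h₁, e₁, k₁⟩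
  -- Pairing with `u' + x` forces `u'` and `x` to take different values at `z₂`, so either `z₂` or
  -- `z₁ + z₂` works.
  obtain ⟨z₂, h₂, k₂⟩ := exists_symp_zero_one (x := u) (y := u' + x)
    (fun h => hu' (label_add_eq_zero.mp h).symm) (fun h => huu (label_add_eq_iff.mp h))
  rw [symp_add_left] at k₂
  rcases zmod_two_cases (symp u' z₂) with e₂ | e₂
  · exact ⟨z₂, h₂, e₂, by simpa [e₂] using k₂⟩
  · have hx₂ : symp x z₂ = 0 := by simpa [e₂] using k₂
    exact ⟨z₁ + z₂, by simp [symp_add_right, *, one_add_one_zmod_two]⟩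

theorem card_label (m : ℕ) : (Fintype.card (Label m) : ℂ) = ((2 : ℂ) ^ m) ^ 2 := by
  simp [ZMod.card, ← pow_mul, mul_two]

/-- Orthogonality of characters on `𝔽₂^{2m}`. -/
theorem sum_sgn_symp (b : Label m) :
    ∑ h : Label m, sgn (symp h b) = if b = 0 then ((2 : ℂ) ^ m) ^ 2 else 0 := by
  split_ifs with hb
  · subst hb
    simp [← card_label]
  · obtain ⟨z, hz⟩ := exists_symp_eq_one hb
    -- Translation by `z` changes the sign of every term, so the sum equals its negative.
    have h : ∑ h : Label m, sgn (symp h b) = ∑ h : Label m, sgn (symp (z + h) b) :=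
      (Equiv.sum_comp (Equiv.addLeft z) fun h => sgn (symp h b)).symm
    simp only [symp_add_left, sgn_add, symp_comm z b, hz, sgn_one, neg_mul, one_mul,
      Finset.sum_neg_distrib] at h
    linear_combination h / 2

theorem sum_sgn_symp_mul (b c : Label m) :
    ∑ h : Label m, sgn (symp h b) * sgn (symp h c) =
      if b = c then ((2 : ℂ) ^ m) ^ 2 else 0 := by
  simp only [← sgn_add, ← symp_add_right, sum_sgn_symp, label_add_eq_zero]

/-! ### Transvections and their orbits on pairs of labels -/

/-- The symplectic transvection along `v`. -/
def transvection (v : Label m) (x : Label m) : Label m := x + symp x v • v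

theorem transvection_of_eq_zero {v x : Label m} (h : symp x v = 0) : transvection v x = x := by
  simp [transvection, h]

theorem transvection_of_eq_one {v x : Label m} (h : symp x v = 1) : transvection v x = x + v := by
  simp [transvection, h]

theorem transvection_transvection (v x : Label m) : transvection v (transvection v x) = x := by
  rcases zmod_two_cases (symp x v) with h | h
  · rw [transvection_of_eq_zero h, transvection_of_eq_zero h]
  · rw [transvection_of_eq_one h, transvection_of_eq_one (by simp [symp_add_left, h]), add_assoc,
      label_add_self, add_zero]

theorem transvection_add_of_symp_eq_one {x y : Label m} (h : symp x y = 1) :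
    transvection (x + y) x = y := by
  rw [transvection_of_eq_one (by simp [symp_add_right, h]), label_add_cancel]

/-- The transvections act transitively on the nonzero vectors. -/
theorem exists_diag_value {q : Label m → Label m → ℂ}
    (hq : ∀ v x y, q (transvection v x) (transvection v y) = q x y) :
    ∃ α, ∀ x, x ≠ 0 → q x x = α := by
  have step : ∀ x y, symp x y = 1 → q x x = q y y := fun x y h => by
    rw [← hq (x + y) x x, transvection_add_of_symp_eq_one h]
  by_cases h0 : ∃ x₀ : Label m, x₀ ≠ 0
  · obtain ⟨x₀, h₀⟩ := h0
    refine ⟨q x₀ x₀, fun x hx => ?_⟩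
    obtain ⟨z, -, hz, hz'⟩ := exists_symp_zero_one_one hx hx h₀ h₀
    rw [step x z hz, ← step x₀ z hz']
  · push Not at h0
    -- Without nonzero labels (`m = 0`) any value serves.
    exact ⟨0, fun x hx => absurd (h0 x) hx⟩

/-- If `q` is invariant under transvections, it takes equal values on `(x, y)` and `(x, y')`
when both pairs are distinct and have the same symplectic product. -/
theorem transvection_invariant_right {q : Label m → Label m → ℂ}
    (hq : ∀ v x y, q (transvection v x) (transvection v y) = q x y) {x y y' : Label m}
    (hy : y ≠ 0) (hy' : y' ≠ 0) (hx : x ≠ 0) (hxy : x ≠ y) (hxy' : x ≠ y')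
    (h : symp x y = symp x y') : q x y = q x y' := by
  -- The transvection along `y + y'` takes `y` to `y'` and fixes `x`. Orthogonal `y`, `y'` will be
  -- joined through a `z` non-orthogonal to both with `symp x z = symp x y`.
  have step : ∀ y y', symp x y = symp x y' → symp y y' = 1 → q x y = q x y' := by
    intro y y' h h1
    rw [← hq (y + y') x y, transvection_add_of_symp_eq_one h1,
      transvection_of_eq_zero (by rw [symp_add_right, h]; exact CharTwo.add_self_eq_zero _)]
  rcases zmod_two_cases (symp y y') with h0 | h1
  swap
  · exact step y y' h h1
  rcases eq_or_ne y y' with rfl | hne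
  · rfl
  rcases zmod_two_cases (symp x y) with e | e
  · obtain ⟨z, hz₁, hz₂, hz₃⟩ := exists_symp_zero_one_one hy hxy.symm hy' hxy'.symm
    rw [step y z (by rw [e, hz₁]) hz₂, step y' z (by rw [← h, e, hz₁]) hz₃]
  · have hsum : x ≠ y + y' := by
      rintro rfl
      simp [symp_add_left, h0, symp_comm y' y] at e
    have e' : symp x y' = 1 := h ▸ e
    -- Vanishing on `x + y` and `x + y'` while pairing to one with `x` gives value one on `x`, `y`
    -- and `y'` together.
    obtain ⟨z, hz₁, hz₂, hz₃⟩ := exists_symp_zero_zero_one (u := x + y) (u' := x + y') (x := x) hx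
      (fun h => hy (by simpa using h)) (fun h => hy' (by simpa using h))
      (fun h => hsum (h.trans (by rw [add_add_add_comm, label_add_self, zero_add, add_comm])))
    rw [symp_add_left, hz₃] at hz₁ hz₂
    have k₁ : symp y z = 1 := by
      rcases zmod_two_cases (symp y z) with k | k
      · simp [k] at hz₁
      · exact k
    have k₂ : symp y' z = 1 := by
      rcases zmod_two_cases (symp y' z) with k | k
      · simp [k] at hz₂
      · exact k
    rw [step y z (by rw [e, hz₃]) k₁, step y' z (by rw [e', hz₃]) k₂]

theorem symp_transvection (v x y : Label m) :
    symp (transvection v x) (transvection v y) = symp x y := by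
  rcases zmod_two_cases (symp x v) with h | h <;> rcases zmod_two_cases (symp y v) with h' | h' <;>
    simp [transvection, h, h', symp_add_left, symp_add_right, symp_comm v y, add_assoc,
      one_add_one_zmod_two]

theorem transvection_injective (v : Label m) : Function.Injective (transvection v) :=
  Function.LeftInverse.injective (transvection_transvection v)

theorem transvection_zero (v : Label m) : transvection v 0 = 0 := by simp [transvection]

theorem transvection_ne_zero (v : Label m) {x : Label m} (hx : x ≠ 0) : transvection v x ≠ 0 :=
  fun h => hx (transvection_injective v (h.trans (transvection_zero v).symm))

/-- The transvections act transitively on the pairs of distinct nonzero vectors with a given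
symplectic product. -/
theorem exists_offdiag_value {q : Label m → Label m → ℂ}
    (hq : ∀ v x y, q (transvection v x) (transvection v y) = q x y) (c : ZMod 2) :
    ∃ β, ∀ x y, x ≠ 0 → y ≠ 0 → x ≠ y → symp x y = c → q x y = β := by
  -- One transvection moves the first entry to `x'`; the second entry is then adjusted with the
  -- first held fixed.
  have step : ∀ x x' y y', symp x x' = 1 → x' ≠ 0 → y ≠ 0 → y' ≠ 0 → x ≠ y → x' ≠ y' →
      symp x y = symp x' y' → q x y = q x' y' := by
    intro x x' y y' h hx' hy hy' hxy hxy' hs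
    have hT := transvection_add_of_symp_eq_one h
    rw [← hq (x + x') x y, hT]
    refine transvection_invariant_right hq (transvection_ne_zero _ hy) hy' hx' ?_ hxy' ?_
    · exact fun h => hxy (transvection_injective _ (hT.trans h))
    · rw [← hs, ← symp_transvection (x + x') x y, hT]
  by_cases h0 : ∃ x y : Label m, x ≠ 0 ∧ y ≠ 0 ∧ x ≠ y ∧ symp x y = c
  · obtain ⟨x₀, y₀, hx₀, hy₀, hxy₀, hs₀⟩ := h0
    refine ⟨q x₀ y₀, fun x y hx hy hxy hs => ?_⟩
    obtain ⟨z, -, hz, hz'⟩ := exists_symp_zero_one_one hx hx hx₀ hx₀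
    have hz0 : z ≠ 0 := by rintro rfl; simp at hz
    have hT := transvection_add_of_symp_eq_one hz
    have hzy : z ≠ transvection (x + z) y :=
      fun h => hxy (transvection_injective _ (hT.trans h))
    have hzs : symp z (transvection (x + z) y) = c := by
      rw [← hs, ← symp_transvection (x + z) x y, hT]
    rw [step x z y _ hz hz0 hy (transvection_ne_zero (x + z) hy) hxy hzy (by rw [hs, hzs]),
      step x₀ z y₀ _ hz' hz0 hy₀ (transvection_ne_zero (x + z) hy) hxy₀ hzy (by rw [hs₀, hzs])]
  · push Not at h0
    exact ⟨0, fun x y hx hy hxy hs => absurd hs (h0 x y hx hy hxy)⟩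

/-! ### Tensor products and the algebra of Pauli operators -/

section Tensor

variable {ι n : Type*} [Fintype ι]

theorem tensor_smul (c : ι → ℂ) (A : ι → Matrix n n ℂ) :
    tensor (fun k => c k • A k) = (∏ k, c k) • tensor A := by
  ext i j
  simp [tensor, Finset.prod_mul_distrib]

theorem trace_tensor [DecidableEq ι] [Fintype n] (A : ι → Matrix n n ℂ) :
    (tensor A).trace = ∏ k, (A k).trace := by
  simp only [tensor, Matrix.trace, Matrix.diag, Matrix.of_apply, Finset.prod_univ_sum,
    Fintype.piFinset_univ]

end Tensor

/-- The Hermitian one-qubit Pauli operator with label `(x, z)`. -/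
def qubitPauli (x z : ZMod 2) : Matrix (Fin 2) (Fin 2) ℂ :=
  Complex.I ^ (x.val * z.val) • (pauliX ^ x.val * pauliZ ^ z.val)

/-- The phase of a product of two one-qubit Pauli operators. -/
def qubitPhase (x z x' z' : ZMod 2) : ℂ :=
  Complex.I ^ (x.val * z.val + x'.val * z'.val) *
    (-1) ^ (z.val * x'.val) * (-Complex.I) ^ ((x + x').val * (z + z').val)

theorem two_pow_ne_zero (m : ℕ) : (2 : ℂ) ^ m ≠ 0 := pow_ne_zero m two_ne_zero

theorem val_one_zmod_two : (1 : ZMod 2).val = 1 := rfl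

/-- The factors of `qubitPhase` are the Hermitian phases of the two operands, the sign from moving
`Z^z` past `X^{x'}`, and the inverse of the Hermitian phase of the product label. -/
theorem qubitPauli_mul (x z x' z' : ZMod 2) :
    qubitPauli x z * qubitPauli x' z' =
      qubitPhase x z x' z' • qubitPauli (x + x') (z + z') := by
  rcases zmod_two_cases x with rfl | rfl <;> rcases zmod_two_cases z with rfl | rfl <;>
  rcases zmod_two_cases x' with rfl | rfl <;> rcases zmod_two_cases z' with rfl | rfl <;>
  ext i j <;> fin_cases i <;> fin_cases j <;>
  simp [qubitPauli, qubitPhase, one_add_one_zmod_two, pauliX, pauliZ, val_one_zmod_two, pow_succ]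

theorem qubitPhase_comm (x z x' z' : ZMod 2) :
    qubitPhase x z x' z' = sgn (x * z' + z * x') * qubitPhase x' z' x z := by
  rcases zmod_two_cases x with rfl | rfl <;> rcases zmod_two_cases z with rfl | rfl <;>
  rcases zmod_two_cases x' with rfl | rfl <;> rcases zmod_two_cases z' with rfl | rfl <;>
  simp [qubitPhase, one_add_one_zmod_two, val_one_zmod_two, pow_succ]

theorem star_qubitPhase_mul_self (x z x' z' : ZMod 2) :
    (starRingEnd ℂ) (qubitPhase x z x' z') * qubitPhase x z x' z' = 1 := by
  rcases zmod_two_cases x with rfl | rfl <;> rcases zmod_two_cases z with rfl | rfl <;>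
  rcases zmod_two_cases x' with rfl | rfl <;> rcases zmod_two_cases z' with rfl | rfl <;>
  simp [qubitPhase, one_add_one_zmod_two, val_one_zmod_two, pow_succ]

theorem qubitPhase_self (x z : ZMod 2) : qubitPhase x z x z = 1 := by
  rcases zmod_two_cases x with rfl | rfl <;> rcases zmod_two_cases z with rfl | rfl <;>
  simp [qubitPhase, one_add_one_zmod_two, val_one_zmod_two, pow_succ]

theorem conjTranspose_qubitPauli (x z : ZMod 2) : (qubitPauli x z)ᴴ = qubitPauli x z := by
  rcases zmod_two_cases x with rfl | rfl <;> rcases zmod_two_cases z with rfl | rfl <;>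
  ext i j <;> fin_cases i <;> fin_cases j <;>
  simp [qubitPauli, pauliX, pauliZ, val_one_zmod_two, Matrix.conjTranspose_apply]

theorem trace_qubitPauli (x z : ZMod 2) :
    (qubitPauli x z).trace = if x = 0 ∧ z = 0 then 2 else 0 := by
  rcases zmod_two_cases x with rfl | rfl <;> rcases zmod_two_cases z with rfl | rfl <;>
  simp [qubitPauli, pauliX, pauliZ, val_one_zmod_two, Matrix.trace]

theorem pauli_eq_tensor (a : Label m) :
    pauli a = tensor fun j => qubitPauli (a (Sum.inl j)) (a (Sum.inr j)) := by
  simp only [pauli, qubitPauli, tensor_smul, tensor_mul, Finset.prod_pow_eq_pow_sum]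

/-- The phase in `E(a) E(b) = ω(a,b) E(a+b)`. -/
def pauliPhase (a b : Label m) : ℂ :=
  ∏ j : Fin m, qubitPhase (a (Sum.inl j)) (a (Sum.inr j)) (b (Sum.inl j)) (b (Sum.inr j))

theorem pauli_mul (a b : Label m) : pauli a * pauli b = pauliPhase a b • pauli (a + b) := by
  simp only [pauli_eq_tensor, tensor_mul, qubitPauli_mul, tensor_smul, pauliPhase, Pi.add_apply]

theorem sgn_sum {ι : Type*} (s : Finset ι) (f : ι → ZMod 2) :
    sgn (∑ i ∈ s, f i) = ∏ i ∈ s, sgn (f i) := by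
  classical
  induction s using Finset.induction_on with
  | empty => simp
  | insert i s hi ih => rw [Finset.sum_insert hi, Finset.prod_insert hi, sgn_add, ih]

theorem pauliPhase_comm (a b : Label m) : pauliPhase a b = sgn (symp a b) * pauliPhase b a := by
  simp only [pauliPhase, symp, sgn_sum, ← Finset.prod_mul_distrib]
  exact Finset.prod_congr rfl fun j _ => qubitPhase_comm _ _ _ _

theorem pauli_mul_comm (a b : Label m) :
    pauli a * pauli b = sgn (symp a b) • (pauli b * pauli a) := by
  rw [pauli_mul, pauli_mul, smul_smul, ← pauliPhase_comm, add_comm]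

theorem star_pauliPhase_mul_self (a b : Label m) :
    (starRingEnd ℂ) (pauliPhase a b) * pauliPhase a b = 1 := by
  simp only [pauliPhase, map_prod, ← Finset.prod_mul_distrib]
  exact Finset.prod_eq_one fun j _ => star_qubitPhase_mul_self _ _ _ _

theorem pauliPhase_ne_zero (a b : Label m) : pauliPhase a b ≠ 0 := by
  intro h
  simpa [h] using star_pauliPhase_mul_self a b

theorem conjTranspose_pauli (a : Label m) : (pauli a)ᴴ = pauli a := by
  simp only [pauli_eq_tensor, tensor_conjTranspose, conjTranspose_qubitPauli]

theorem pauli_zero : pauli (0 : Label m) = 1 := by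
  simp [pauli, tensor_one]

theorem pauli_mul_self (a : Label m) : pauli a * pauli a = 1 := by
  have h : pauliPhase a a = 1 := Finset.prod_eq_one fun j _ => qubitPhase_self _ _
  rw [pauli_mul, h, label_add_self, pauli_zero, one_smul]

theorem trace_pauli (a : Label m) : (pauli a).trace = if a = 0 then (2 : ℂ) ^ m else 0 := by
  simp only [pauli_eq_tensor, trace_tensor, trace_qubitPauli]
  split_ifs with h
  · simp [h]
  · obtain ⟨j, hj⟩ := Function.ne_iff.mp h
    rcases j with j | j
    · exact Finset.prod_eq_zero (Finset.mem_univ j) (if_neg fun h => hj h.1)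
    · exact Finset.prod_eq_zero (Finset.mem_univ j) (if_neg fun h => hj h.2)

theorem trace_pauli_mul (a b : Label m) :
    (pauli a * pauli b).trace = if a = b then (2 : ℂ) ^ m else 0 := by
  split_ifs with h
  · rw [h, pauli_mul_self, ← pauli_zero, trace_pauli, if_pos rfl]
  · rw [pauli_mul, Matrix.trace_smul, trace_pauli, if_neg (fun e => h (label_add_eq_zero.mp e)),
      smul_zero]

theorem pauli_ne_zero (a : Label m) : pauli a ≠ 0 := by
  intro h
  have h2 := trace_pauli_mul a a
  rw [h, Matrix.zero_mul, Matrix.trace_zero, if_pos rfl] at h2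
  exact two_pow_ne_zero m h2.symm

/-- Proportional Pauli operators have the same label. -/
theorem label_eq_of_pauli_eq_smul {a b : Label m} {c : ℂ} (h : pauli a = c • pauli b) : a = b := by
  by_contra hne
  have h1 := trace_pauli_mul a a
  nth_rw 2 [h] at h1
  rw [Matrix.mul_smul, Matrix.trace_smul, trace_pauli_mul, if_neg hne, smul_zero,
    if_pos rfl] at h1
  exact two_pow_ne_zero m h1.symm

/-! ### The three-copy basis, the operators `W_σ` and the projectors -/

/-- The phase of `|a₁,a₂,a₃⟩` relative to `N^{-3/2} E(a₁) ⊗ E(a₂) ⊗ E(a₃)`. -/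
def ketPhase (a : Fin 3 → Label m) : ℂ :=
  if a 0 + a 1 + a 2 = 0 then Complex.I ^ (symp (a 0) (a 1)).val * pauliPhase (a 0) (a 1) else 1

theorem star_ketPhase_mul_self (a : Fin 3 → Label m) :
    (starRingEnd ℂ) (ketPhase a) * ketPhase a = 1 := by
  unfold ketPhase
  split_ifs with h
  · have hI : (starRingEnd ℂ) (Complex.I ^ (symp (a 0) (a 1)).val) *
        Complex.I ^ (symp (a 0) (a 1)).val = 1 := by
      rw [map_pow, ← mul_pow]; simp
    rw [map_mul, mul_mul_mul_comm, hI, star_pauliPhase_mul_self, one_mul]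
  · simp

/-- The normalization `N^{-3/2}`. -/
def ketNorm (m : ℕ) : ℂ := (((Real.sqrt (((2 : ℝ) ^ m) ^ 3))⁻¹ : ℝ) : ℂ)

theorem ketNorm_mul_self (m : ℕ) : ketNorm m * ketNorm m * ((2 : ℂ) ^ m) ^ 3 = 1 := by
  have h : (Real.sqrt (((2 : ℝ) ^ m) ^ 3))⁻¹ * (Real.sqrt (((2 : ℝ) ^ m) ^ 3))⁻¹ *
      ((2 : ℝ) ^ m) ^ 3 = 1 := by
    rw [← mul_inv, Real.mul_self_sqrt (by positivity)]
    exact inv_mul_cancel₀ (by positivity)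
  rw [ketNorm]
  exact_mod_cast congrArg (fun x : ℝ => (x : ℂ)) h

/-- If the labels sum to zero, the factor `E(a₁)E(a₂)` is a phase times `E(a₃)`. Thus both cases of
`ket₃` are a unimodular multiple of one normalized Pauli tensor, and inner products need no case
distinction on the labels. -/
theorem ket₃_eq (a : Fin 3 → Label m) :
    ket₃ a = (ketNorm m * ketPhase a) • tensor fun k => pauli (a k) := by
  unfold ket₃ ketPhase
  rw [mul_smul]
  change ketNorm m • _ = _
  congr 1
  split_ifs with h
  · have h2 : a 2 = a 0 + a 1 := (label_add_eq_zero.mp h).symm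
    have : (![pauli (a 0), pauli (a 1), pauli (a 0) * pauli (a 1)] :
        Fin 3 → Matrix (Bits m) (Bits m) ℂ) =
        fun k => (![1, 1, pauliPhase (a 0) (a 1)] : Fin 3 → ℂ) k • pauli (a k) := by
      funext k
      fin_cases k <;> simp [pauli_mul, h2]
    rw [this, tensor_smul, Fin.prod_univ_three, smul_smul]
    simp
  · rw [one_smul]

theorem frob_apply (t : ℕ) (A B : Op m t) : frob m t A B = (Aᴴ * B).trace := rfl

theorem frob_tensor_pauli {t : ℕ} (a b : Fin t → Label m) :
    frob m t (tensor fun k => pauli (a k)) (tensor fun k => pauli (b k)) =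
      if a = b then ((2 : ℂ) ^ m) ^ t else 0 := by
  rw [frob_apply, tensor_conjTranspose, tensor_mul, trace_tensor]
  simp only [conjTranspose_pauli, trace_pauli_mul]
  split_ifs with h
  · simp [h]
  · obtain ⟨k, hk⟩ := Function.ne_iff.mp h
    exact Finset.prod_eq_zero (Finset.mem_univ k) (if_neg hk)

theorem frob_ket₃ (a b : Fin 3 → Label m) :
    frob m 3 (ket₃ a) (ket₃ b) = if a = b then 1 else 0 := by
  have hN : (starRingEnd ℂ) (ketNorm m) = ketNorm m := Complex.conj_ofReal _
  rw [ket₃_eq, ket₃_eq, LinearMap.map_smulₛₗ₂, map_smul, frob_tensor_pauli, map_mul, hN]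
  split_ifs with h
  · subst h
    simp only [smul_eq_mul]
    linear_combination (ketNorm m * ketNorm m * ((2 : ℂ) ^ m) ^ 3) * star_ketPhase_mul_self a +
      ketNorm_mul_self m
  · simp

theorem frob_ket₂ (a b : Label m) :
    frob m 2 (ket₂ a) (ket₂ b) = if a = b then 1 else 0 := by
  have h2 := two_pow_ne_zero m
  have hs : (starRingEnd ℂ) (((2 : ℂ) ^ m)⁻¹) = ((2 : ℂ) ^ m)⁻¹ := by
    rw [map_inv₀, map_pow, Complex.conj_ofNat]
  rw [ket₂, ket₂, LinearMap.map_smulₛₗ₂, map_smul,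
    frob_tensor_pauli (fun _ : Fin 2 => a) (fun _ => b)]
  have : ((fun _ : Fin 2 => a) = fun _ => b) ↔ a = b :=
    ⟨fun h => congrFun h 0, fun h => by rw [h]⟩
  simp only [this, hs]
  split_ifs
  · simp only [smul_eq_mul]; field_simp
  · simp

theorem frob_conj_symm {t : ℕ} (A B : Op m t) :
    (starRingEnd ℂ) (frob m t A B) = frob m t B A := by
  rw [frob_apply, frob_apply, starRingEnd_apply, ← Matrix.trace_conjTranspose,
    Matrix.conjTranspose_mul, Matrix.conjTranspose_conjTranspose]

theorem ket₃_linearIndependent (m : ℕ) :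
    LinearIndependent ℂ (ket₃ : (Fin 3 → Label m) → Op m 3) := by
  rw [Fintype.linearIndependent_iff]
  intro c hc a
  have h := congrArg (frob m 3 (ket₃ a)) hc
  simpa [map_sum, frob_ket₃] using h

/-- The vectors `|a₁,a₂,a₃⟩` span the three-copy operator space. -/
theorem span_ket₃ (m : ℕ) :
    Submodule.span ℂ (Set.range (ket₃ : (Fin 3 → Label m) → Op m 3)) = ⊤ := by
  refine (ket₃_linearIndependent m).span_eq_top_of_card_eq_finrank' ?_
  simp only [Fintype.card_pi, Finset.prod_const, Finset.card_univ, ZMod.card, Fintype.card_fin,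
    Fintype.card_sum, Module.finrank_matrix, Module.finrank_self]
  ring

theorem linearMap_ext_ket₃ {M : Type*} [AddCommMonoid M] [Module ℂ M] {f g : Op m 3 →ₗ[ℂ] M}
    (h : ∀ a, f (ket₃ a) = g (ket₃ a)) : f = g :=
  LinearMap.ext_on_range (span_ket₃ m) h

theorem permW_ket₃ (σ : Equiv.Perm (Fin 3)) (a : Fin 3 → Label m) :
    permW m σ (ket₃ a) = ket₃ (a ∘ ⇑σ⁻¹) := by
  simp [permW, LinearMap.sum_apply, frob_ket₃]

theorem permW_one (m : ℕ) : permW m 1 = LinearMap.id :=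
  linearMap_ext_ket₃ fun a => by simp [permW_ket₃]

theorem permW_mul (σ τ : Equiv.Perm (Fin 3)) : permW m (σ * τ) = permW m σ * permW m τ :=
  linearMap_ext_ket₃ fun a => by
    simp only [Module.End.mul_apply, permW_ket₃, _root_.mul_inv_rev]
    rfl

/-- `permW` permutes an orthonormal basis, so its adjoint is its inverse; the proof reindexes the
basis expansion by `σ`. -/
theorem frob_permW_left (σ : Equiv.Perm (Fin 3)) (X Y : Op m 3) :
    frob m 3 (permW m σ X) Y = frob m 3 X (permW m σ⁻¹ Y) := by
  have h : (permW m σ⁻¹ : Op m 3 →ₗ[ℂ] Op m 3) =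
      ∑ a : Fin 3 → Label m, (frob m 3 (ket₃ (a ∘ ⇑σ⁻¹))).smulRight (ket₃ a) := by
    rw [permW]
    refine (Fintype.sum_equiv (Equiv.arrowCongr σ (Equiv.refl (Label m))) _ _ fun a => ?_).symm
    simp only [inv_inv]
    congr 2
    funext k
    simp [Function.comp_def]
  rw [h]
  simp only [permW, LinearMap.sum_apply, LinearMap.smulRight_apply, map_sum, map_smul, smul_eq_mul,
    LinearMap.map_smulₛₗ₂, frob_conj_symm]
  exact Finset.sum_congr rfl fun a _ => mul_comm _ _

theorem permW_finRotate_mul_self (m : ℕ) :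
    permW m (finRotate 3) * permW m (finRotate 3) = permW m (finRotate 3)⁻¹ := by
  rw [← permW_mul]
  congr 1
  decide

theorem permW_finRotate_inv_mul_self (m : ℕ) :
    permW m (finRotate 3)⁻¹ * permW m (finRotate 3)⁻¹ = permW m (finRotate 3) := by
  rw [← permW_mul]
  congr 1
  decide

/-- With `c` a 3-cycle, `(c + c⁻¹)² = c² + c⁻² + 2` and `c² = c⁻¹`. This one relation gives
idempotence of both projectors and the vanishing of their product. -/
theorem cycSum_mul_self (m : ℕ) :
    cycSum m * cycSum m = cycSum m + (2 : ℂ) • (1 : Module.End ℂ (Op m 3)) := by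
  have h1 : permW m (finRotate 3) * permW m (finRotate 3)⁻¹ = 1 := by
    rw [← permW_mul, mul_inv_cancel, permW_one]; rfl
  have h2 : permW m (finRotate 3)⁻¹ * permW m (finRotate 3) = 1 := by
    rw [← permW_mul, inv_mul_cancel, permW_one]; rfl
  rw [cycSum, add_mul, mul_add, mul_add, h1, h2, permW_finRotate_mul_self,
    permW_finRotate_inv_mul_self, two_smul]
  abel

theorem projS_eq (m : ℕ) : projS m = (1 / 3 : ℂ) • ((1 : Module.End ℂ (Op m 3)) + cycSum m) := rfl

theorem projOne_eq (m : ℕ) :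
    projOne m = (1 / 3 : ℂ) • ((2 : ℂ) • (1 : Module.End ℂ (Op m 3)) - cycSum m) := rfl

theorem isIdempotentElem_projS (m : ℕ) : IsIdempotentElem (projS m) := by
  rw [IsIdempotentElem, projS_eq, smul_mul_smul_comm, add_mul, mul_add, mul_add, cycSum_mul_self]
  simp only [one_mul, mul_one]
  module

theorem isIdempotentElem_projOne (m : ℕ) : IsIdempotentElem (projOne m) := by
  rw [IsIdempotentElem, projOne_eq, smul_mul_smul_comm, sub_mul, mul_sub, mul_sub, cycSum_mul_self]
  simp only [smul_mul_assoc, mul_smul_comm, one_mul, mul_one]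
  module

theorem projS_mul_projOne (m : ℕ) : projS m * projOne m = 0 := by
  rw [projS_eq, projOne_eq, smul_mul_smul_comm, add_mul, mul_sub, mul_sub, cycSum_mul_self]
  simp only [mul_smul_comm, one_mul, mul_one]
  module

theorem frob_cycSum_left (X Y : Op m 3) :
    frob m 3 (cycSum m X) Y = frob m 3 X (cycSum m Y) := by
  simp only [cycSum, LinearMap.add_apply, map_add, frob_permW_left, inv_inv]
  exact add_comm _ _

theorem frob_projS_left (X Y : Op m 3) :
    frob m 3 (projS m X) Y = frob m 3 X (projS m Y) := by
  simp [projS, frob_cycSum_left, Complex.conj_ofNat]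

theorem frob_projOne_left (X Y : Op m 3) :
    frob m 3 (projOne m X) Y = frob m 3 X (projOne m Y) := by
  simp [projOne, frob_cycSum_left, Complex.conj_ofNat]

/-! ### The action of the Clifford group on labels -/

theorem exists_conj_pauli (g : cliffordGroup m) (a : Label m) :
    ∃ p : ℂ × Label m, (p.1 = 1 ∨ p.1 = -1) ∧
      (g.1 : Matrix (Bits m) (Bits m) ℂ) * pauli a * (g.1 : Matrix (Bits m) (Bits m) ℂ)ᴴ =
        p.1 • pauli p.2 := by
  obtain ⟨b, hb | hb⟩ := g.2 a
  · exact ⟨(1, b), Or.inl rfl, by rw [hb, one_smul]⟩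
  · exact ⟨(-1, b), Or.inr rfl, by rw [hb, neg_one_smul]⟩

/-- The sign `s` in `U E(a) U† = s E(b)`. -/
def conjSign (g : cliffordGroup m) (a : Label m) : ℂ := (exists_conj_pauli g a).choose.1

/-- The label `b` in `U E(a) U† = ± E(b)`. -/
def conjLabel (g : cliffordGroup m) (a : Label m) : Label m := (exists_conj_pauli g a).choose.2

theorem conj_pauli (g : cliffordGroup m) (a : Label m) :
    (g.1 : Matrix (Bits m) (Bits m) ℂ) * pauli a * (g.1 : Matrix (Bits m) (Bits m) ℂ)ᴴ =
      conjSign g a • pauli (conjLabel g a) :=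
  (exists_conj_pauli g a).choose_spec.2

theorem conjSign_mul_self (g : cliffordGroup m) (a : Label m) :
    conjSign g a * conjSign g a = 1 := by
  rcases (exists_conj_pauli g a).choose_spec.1 with h | h <;> simp [conjSign, h]

theorem conjSign_ne_zero (g : cliffordGroup m) (a : Label m) : conjSign g a ≠ 0 := by
  intro h
  simpa [h] using conjSign_mul_self g a

/-- Proportional Pauli operators have equal labels, so a conjugate only has to be computed up to a
scalar; signs never need to be tracked to identify the label. -/
theorem conjLabel_unique {g : cliffordGroup m} {a b : Label m} {c : ℂ}
    (h : (g.1 : Matrix (Bits m) (Bits m) ℂ) * pauli a * (g.1 : Matrix (Bits m) (Bits m) ℂ)ᴴ =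
      c • pauli b) : conjLabel g a = b := by
  rw [conj_pauli] at h
  refine label_eq_of_pauli_eq_smul (c := conjSign g a * c) ?_
  rw [mul_smul, ← h, smul_smul, conjSign_mul_self, one_smul]

theorem star_mul_self_clifford (g : cliffordGroup m) :
    (g.1 : Matrix (Bits m) (Bits m) ℂ)ᴴ * (g.1 : Matrix (Bits m) (Bits m) ℂ) = 1 :=
  Matrix.UnitaryGroup.star_mul_self g.1

theorem conj_mul (g : cliffordGroup m) (A B : Matrix (Bits m) (Bits m) ℂ) :
    (g.1 : Matrix (Bits m) (Bits m) ℂ) * (A * B) * (g.1 : Matrix (Bits m) (Bits m) ℂ)ᴴ =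
      ((g.1 : Matrix (Bits m) (Bits m) ℂ) * A * (g.1 : Matrix (Bits m) (Bits m) ℂ)ᴴ) *
      ((g.1 : Matrix (Bits m) (Bits m) ℂ) * B * (g.1 : Matrix (Bits m) (Bits m) ℂ)ᴴ) := by
  calc _ = (g.1 : Matrix (Bits m) (Bits m) ℂ) * A * 1 * B *
        (g.1 : Matrix (Bits m) (Bits m) ℂ)ᴴ := by simp only [Matrix.mul_one, Matrix.mul_assoc]
    _ = _ := by rw [← star_mul_self_clifford g]; simp only [Matrix.mul_assoc]

theorem conj_pauli_mul (g : cliffordGroup m) (a b : Label m) :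
    (g.1 : Matrix (Bits m) (Bits m) ℂ) * (pauli a * pauli b) *
        (g.1 : Matrix (Bits m) (Bits m) ℂ)ᴴ =
      (conjSign g a * conjSign g b) • (pauli (conjLabel g a) * pauli (conjLabel g b)) := by
  rw [conj_mul, conj_pauli, conj_pauli, smul_mul_smul_comm]

theorem conjLabel_add (g : cliffordGroup m) (a b : Label m) :
    conjLabel g (a + b) = conjLabel g a + conjLabel g b := by
  have h : pauli (a + b) = (pauliPhase a b)⁻¹ • (pauli a * pauli b) := by
    rw [pauli_mul, smul_smul, inv_mul_cancel₀ (pauliPhase_ne_zero a b), one_smul]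
  refine conjLabel_unique (c := (pauliPhase a b)⁻¹ * (conjSign g a * conjSign g b *
    pauliPhase (conjLabel g a) (conjLabel g b))) ?_
  rw [h, Matrix.mul_smul, Matrix.smul_mul, conj_pauli_mul, pauli_mul, smul_smul, smul_smul, mul_assoc]

theorem sgn_injective : Function.Injective sgn := by
  intro x y h
  rcases zmod_two_cases x with rfl | rfl <;> rcases zmod_two_cases y with rfl | rfl
  · rfl
  · norm_num at h
  · norm_num at h
  · rfl

/-- The symplectic form is the commutation sign of Pauli operators, and conjugation preserves
commutation relations. -/
theorem symp_conjLabel (g : cliffordGroup m) (a b : Label m) :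
    symp (conjLabel g a) (conjLabel g b) = symp a b := by
  have h := conj_pauli_mul g a b
  rw [pauli_mul_comm a b, pauli_mul_comm (conjLabel g a), Matrix.mul_smul, Matrix.smul_mul,
    conj_pauli_mul, smul_smul, smul_smul, pauli_mul, smul_smul, smul_smul] at h
  have h' := smul_left_injective ℂ (pauli_ne_zero (conjLabel g b + conjLabel g a)) h
  refine (sgn_injective ?_).symm
  have h1 := conjSign_ne_zero g a
  have h2 := conjSign_ne_zero g b
  have h3 := pauliPhase_ne_zero (conjLabel g b) (conjLabel g a)
  have h4 : (sgn (symp a b) - sgn (symp (conjLabel g a) (conjLabel g b))) *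
      (conjSign g a * conjSign g b * pauliPhase (conjLabel g b) (conjLabel g a)) = 0 := by
    linear_combination h'
  exact sub_eq_zero.mp ((mul_eq_zero.mp h4).resolve_right (mul_ne_zero (mul_ne_zero h1 h2) h3))

theorem conjLabel_one (a : Label m) : conjLabel (1 : cliffordGroup m) a = a :=
  conjLabel_unique (c := 1) (by simp)

theorem conjLabel_mul (g h : cliffordGroup m) (a : Label m) :
    conjLabel (g * h) a = conjLabel g (conjLabel h a) := by
  refine conjLabel_unique (c := conjSign h a * conjSign g (conjLabel h a)) ?_
  calc _ = (g.1 : Matrix (Bits m) (Bits m) ℂ) * ((h.1 : Matrix (Bits m) (Bits m) ℂ) * pauli a *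
        (h.1 : Matrix (Bits m) (Bits m) ℂ)ᴴ) * (g.1 : Matrix (Bits m) (Bits m) ℂ)ᴴ := by
        simp [Matrix.mul_assoc]
    _ = _ := by rw [conj_pauli, Matrix.mul_smul, Matrix.smul_mul, conj_pauli, smul_smul]

/-- The symplectic transformation of labels induced by a Clifford unitary. -/
def labelEquiv (g : cliffordGroup m) : Label m ≃+ Label m where
  toFun := conjLabel g
  invFun := conjLabel g⁻¹
  left_inv a := by rw [← conjLabel_mul, inv_mul_cancel, conjLabel_one]
  right_inv a := by rw [← conjLabel_mul, mul_inv_cancel, conjLabel_one]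
  map_add' := conjLabel_add g

theorem labelEquiv_one (a : Label m) : labelEquiv (1 : cliffordGroup m) a = a := conjLabel_one a

theorem labelEquiv_mul (g h : cliffordGroup m) (a : Label m) :
    labelEquiv (g * h) a = labelEquiv g (labelEquiv h a) := conjLabel_mul g h a

theorem symp_labelEquiv (g : cliffordGroup m) (a b : Label m) :
    symp (labelEquiv g a) (labelEquiv g b) = symp a b := symp_conjLabel g a b

/-! ### Transvections are induced by Clifford unitaries -/

/-- The matrix `(1 + i E(v)) / √2`. -/
def transvectionMatrix (v : Label m) : Matrix (Bits m) (Bits m) ℂ :=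
  ((Real.sqrt 2)⁻¹ : ℂ) • (1 + Complex.I • pauli v)

theorem inv_sqrt_two_mul_self : ((Real.sqrt 2)⁻¹ : ℂ) * ((Real.sqrt 2)⁻¹ : ℂ) = 1 / 2 := by
  rw [← mul_inv, ← Complex.ofReal_mul, Real.mul_self_sqrt (by norm_num)]
  norm_num

theorem conjTranspose_transvectionMatrix (v : Label m) :
    (transvectionMatrix v)ᴴ = ((Real.sqrt 2)⁻¹ : ℂ) • (1 - Complex.I • pauli v) := by
  simp [transvectionMatrix, Matrix.conjTranspose_smul, Matrix.conjTranspose_add,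
    conjTranspose_pauli, sub_eq_add_neg]

theorem transvectionMatrix_mul_star (v : Label m) :
    transvectionMatrix v * (transvectionMatrix v)ᴴ = 1 := by
  rw [conjTranspose_transvectionMatrix, transvectionMatrix, smul_mul_smul_comm,
    inv_sqrt_two_mul_self, add_mul, mul_sub, mul_sub, smul_mul_smul_comm, pauli_mul_self,
    Complex.I_mul_I]
  simp only [one_mul, mul_one]
  module

theorem transvectionMatrix_mul_self (v : Label m) :
    transvectionMatrix v * transvectionMatrix v = Complex.I • pauli v := by
  rw [transvectionMatrix, smul_mul_smul_comm,
    inv_sqrt_two_mul_self, add_mul, mul_add, mul_add, smul_mul_smul_comm, pauli_mul_self,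
    Complex.I_mul_I]
  simp only [one_mul, mul_one]
  module

/-- With `T` the matrix: if `E(a)` and `E(v)` commute, `E(a)` commutes with `T` and is fixed. If
they anticommute, `E(a) T† = T E(a)`, so the conjugate is `T² E(a) = i E(v) E(a)`, which has label
`a + v`. -/
theorem transvectionMatrix_conj_pauli (v a : Label m) :
    ∃ c : ℂ, transvectionMatrix v * pauli a * (transvectionMatrix v)ᴴ =
      c • pauli (transvection v a) := by
  rcases zmod_two_cases (symp a v) with h | h
  · refine ⟨1, ?_⟩
    have hc : transvectionMatrix v * pauli a = pauli a * transvectionMatrix v := by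
      simp only [transvectionMatrix, Matrix.smul_mul, Matrix.mul_smul, Matrix.add_mul,
        Matrix.mul_add, Matrix.one_mul, Matrix.mul_one, pauli_mul_comm a v, h, sgn_zero, one_smul]
    rw [hc, Matrix.mul_assoc, transvectionMatrix_mul_star, transvection_of_eq_zero h, one_smul,
      Matrix.mul_one]
  · refine ⟨Complex.I * pauliPhase v a, ?_⟩
    have hc : pauli a * (transvectionMatrix v)ᴴ = transvectionMatrix v * pauli a := by
      rw [conjTranspose_transvectionMatrix]
      simp only [transvectionMatrix, Matrix.smul_mul, Matrix.mul_smul, Matrix.add_mul,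
        Matrix.mul_sub, Matrix.one_mul, Matrix.mul_one, pauli_mul_comm a v, h, sgn_one,
        neg_one_smul, smul_neg, sub_neg_eq_add]
    rw [Matrix.mul_assoc, hc, ← Matrix.mul_assoc, transvectionMatrix_mul_self, Matrix.smul_mul,
      pauli_mul, smul_smul, transvection_of_eq_one h, add_comm]

theorem eq_one_or_neg_one_of_smul_pauli_mul_self {c : ℂ} {a : Label m}
    (h : (c • pauli a) * (c • pauli a) = 1) : c = 1 ∨ c = -1 := by
  rw [smul_mul_smul_comm, pauli_mul_self] at h
  have h1 : c * c = 1 := by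
    have := congrArg Matrix.trace h
    rw [Matrix.trace_smul, ← pauli_zero (m := m), trace_pauli, if_pos rfl, smul_eq_mul] at this
    exact mul_right_cancel₀ (two_pow_ne_zero m) (by rw [this, one_mul])
  exact mul_self_eq_one_iff.mp h1

/-- The scalar in the conjugate must be `±1` because the conjugate squares to the identity, as
`E(a)` does. -/
theorem transvectionMatrix_mem_signedPaulis (v a : Label m) :
    transvectionMatrix v * pauli a * (transvectionMatrix v)ᴴ ∈ signedPaulis m := by
  obtain ⟨c, hc⟩ := transvectionMatrix_conj_pauli v a
  have hu : (transvectionMatrix v)ᴴ * transvectionMatrix v = 1 :=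
    mul_eq_one_comm.mp (transvectionMatrix_mul_star v)
  have hsq : (c • pauli (transvection v a)) * (c • pauli (transvection v a)) = 1 := by
    rw [← hc]
    calc _ = transvectionMatrix v * pauli a * ((transvectionMatrix v)ᴴ * transvectionMatrix v) *
          pauli a * (transvectionMatrix v)ᴴ := by simp only [Matrix.mul_assoc]
      _ = 1 := by
        rw [hu, Matrix.mul_one, Matrix.mul_assoc (transvectionMatrix v), pauli_mul_self,
          Matrix.mul_one, transvectionMatrix_mul_star]
  rcases eq_one_or_neg_one_of_smul_pauli_mul_self hsq with rfl | rfl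
  · exact ⟨_, Or.inl (by rw [hc, one_smul])⟩
  · exact ⟨_, Or.inr (by rw [hc, neg_one_smul])⟩

/-- The Clifford unitary `(1 + i E(v)) / √2`. -/
def transvectionClifford (v : Label m) : cliffordGroup m :=
  ⟨⟨transvectionMatrix v, Matrix.mem_unitaryGroup_iff.mpr (transvectionMatrix_mul_star v)⟩,
    transvectionMatrix_mem_signedPaulis v⟩

theorem labelEquiv_transvectionClifford (v a : Label m) :
    labelEquiv (transvectionClifford v) a = transvection v a := by
  obtain ⟨c, hc⟩ := transvectionMatrix_conj_pauli v a
  exact conjLabel_unique hc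

/-! ### Equivariance of the Pauli vectors -/

theorem adjointRep_apply {t : ℕ} (g : cliffordGroup m) (X : Op m t) :
    adjointRep m t g X = (tensor fun _ : Fin t => (g.1 : Matrix (Bits m) (Bits m) ℂ)) * X *
      (tensor fun _ : Fin t => (g.1 : Matrix (Bits m) (Bits m) ℂ))ᴴ := by
  rw [tensor_conjTranspose, Matrix.mul_assoc]
  rfl

theorem adjointRep_tensor {t : ℕ} (g : cliffordGroup m) (A : Fin t → Matrix (Bits m) (Bits m) ℂ) :
    adjointRep m t g (tensor A) = tensor fun k => (g.1 : Matrix (Bits m) (Bits m) ℂ) * A k *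
      (g.1 : Matrix (Bits m) (Bits m) ℂ)ᴴ := by
  rw [adjointRep_apply, tensor_conjTranspose, tensor_mul, tensor_mul]

theorem frob_adjointRep {t : ℕ} (g : cliffordGroup m) (X Y : Op m t) :
    frob m t (adjointRep m t g X) (adjointRep m t g Y) = frob m t X Y := by
  have hu : (tensor fun _ : Fin t => (g.1 : Matrix (Bits m) (Bits m) ℂ))ᴴ *
      (tensor fun _ : Fin t => (g.1 : Matrix (Bits m) (Bits m) ℂ)) = 1 := by
    rw [tensor_conjTranspose, tensor_mul, star_mul_self_clifford, tensor_one]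
  rw [adjointRep_apply, adjointRep_apply, frob_apply, frob_apply]
  generalize (tensor fun _ : Fin t => (g.1 : Matrix (Bits m) (Bits m) ℂ)) = T at hu
  rw [Matrix.conjTranspose_mul, Matrix.conjTranspose_mul, Matrix.conjTranspose_conjTranspose]
  calc _ = (T * (Xᴴ * (Tᴴ * T) * Y) * Tᴴ).trace := by simp only [Matrix.mul_assoc]
    _ = _ := by rw [Matrix.trace_mul_comm, ← Matrix.mul_assoc, hu, Matrix.one_mul, Matrix.mul_one]

theorem adjointRep_ket₂ (g : cliffordGroup m) (a : Label m) :
    adjointRep m 2 g (ket₂ a) = ket₂ (labelEquiv g a) := by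
  simp only [ket₂, map_smul, adjointRep_tensor, conj_pauli]
  rw [tensor_smul (fun _ => conjSign g a) (fun _ => pauli (conjLabel g a)), Fin.prod_univ_two,
    conjSign_mul_self, one_smul]
  rfl

/-- The sign in the action of a Clifford unitary on `|a₁,a₂,a₃⟩`. -/
def ketSign (g : cliffordGroup m) (a : Fin 3 → Label m) : ℂ :=
  if ∑ k, a k = 0 then 1 else ∏ k, conjSign g (a k)

/-- When the labels sum to zero the three factors acquire signs `s₀`, `s₁`, `s₀s₁`, with product
one, and the phase `i^y` is unchanged because the symplectic form is preserved. This absence of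
signs is what the phase convention for `ket₃` provides. -/
theorem adjointRep_ket₃ (g : cliffordGroup m) (a : Fin 3 → Label m) :
    adjointRep m 3 g (ket₃ a) = ketSign g a • ket₃ (fun k => labelEquiv g (a k)) := by
  have hsum : labelEquiv g (a 0) + labelEquiv g (a 1) + labelEquiv g (a 2) = 0 ↔
      a 0 + a 1 + a 2 = 0 := by
    rw [← map_add, ← map_add, map_eq_zero_iff _ (labelEquiv g).injective]
  simp only [ket₃, ketSign, Fin.sum_univ_three, hsum]
  split_ifs with h
  · rw [map_smul, map_smul, adjointRep_tensor, one_smul, symp_labelEquiv]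
    congr 2
    have : (fun k => (g.1 : Matrix (Bits m) (Bits m) ℂ) *
        (![pauli (a 0), pauli (a 1), pauli (a 0) * pauli (a 1)] :
          Fin 3 → Matrix (Bits m) (Bits m) ℂ) k * (g.1 : Matrix (Bits m) (Bits m) ℂ)ᴴ) =
        fun k => (![conjSign g (a 0), conjSign g (a 1), conjSign g (a 0) * conjSign g (a 1)] :
          Fin 3 → ℂ) k • (![pauli (labelEquiv g (a 0)), pauli (labelEquiv g (a 1)),
            pauli (labelEquiv g (a 0)) * pauli (labelEquiv g (a 1))] :
          Fin 3 → Matrix (Bits m) (Bits m) ℂ) k := by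
      funext k
      fin_cases k
      · exact conj_pauli g (a 0)
      · exact conj_pauli g (a 1)
      · exact conj_pauli_mul g (a 0) (a 1)
    rw [this, tensor_smul, Fin.prod_univ_three]
    simp only [Matrix.cons_val]
    rw [mul_mul_mul_comm, conjSign_mul_self, conjSign_mul_self, one_mul, one_smul]
  · rw [map_smul, adjointRep_tensor, smul_comm]
    simp only [conj_pauli]
    rw [tensor_smul]
    rfl

/-- The sign acquired by a basis vector is symmetric in its three labels, so permuting labels
commutes with the action. -/
theorem adjointRep_permW (g : cliffordGroup m) (σ : Equiv.Perm (Fin 3)) (X : Op m 3) :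
    adjointRep m 3 g (permW m σ X) = permW m σ (adjointRep m 3 g X) := by
  have h : adjointRep m 3 g ∘ₗ permW m σ = permW m σ ∘ₗ adjointRep m 3 g := by
    refine linearMap_ext_ket₃ fun a => ?_
    have hs : ketSign g (a ∘ ⇑σ⁻¹) = ketSign g a := by
      have h1 : ∑ k, (a ∘ ⇑σ⁻¹) k = ∑ k, a k := Equiv.sum_comp σ⁻¹ a
      have h2 : ∏ k, conjSign g ((a ∘ ⇑σ⁻¹) k) = ∏ k, conjSign g (a k) :=
        Equiv.prod_comp σ⁻¹ fun k => conjSign g (a k)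
      rw [ketSign, h1, h2, ketSign]
    rw [LinearMap.comp_apply, LinearMap.comp_apply, permW_ket₃, adjointRep_ket₃, adjointRep_ket₃,
      map_smul, permW_ket₃, hs]
    rfl
  exact LinearMap.congr_fun h X

theorem adjointRep_projS (g : cliffordGroup m) (X : Op m 3) :
    adjointRep m 3 g (projS m X) = projS m (adjointRep m 3 g X) := by
  simp [projS, cycSum, adjointRep_permW]

theorem adjointRep_projOne (g : cliffordGroup m) (X : Op m 3) :
    adjointRep m 3 g (projOne m X) = projOne m (adjointRep m 3 g X) := by
  simp [projOne, cycSum, adjointRep_permW]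

/-- The vector `|a,b,a+b⟩`. -/
def triKet (a b : Label m) : Op m 3 := ket₃ ![a, b, a + b]

theorem adjointRep_triKet (g : cliffordGroup m) (a b : Label m) :
    adjointRep m 3 g (triKet a b) = triKet (labelEquiv g a) (labelEquiv g b) := by
  have h : ketSign g ![a, b, a + b] = 1 :=
    if_pos (by simp [Fin.sum_univ_three, label_add_self])
  rw [triKet, adjointRep_ket₃, h, one_smul, triKet]
  congr 1
  funext k
  fin_cases k <;> simp

theorem frob_triKet (a b c d : Label m) :
    frob m 3 (triKet a b) (triKet c d) = if a = c ∧ b = d then 1 else 0 := by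
  rw [triKet, triKet, frob_ket₃]
  congr 1
  refine propext ⟨fun h => ⟨congrFun h 0, congrFun h 1⟩, ?_⟩
  rintro ⟨rfl, rfl⟩
  rfl

theorem permW_finRotate_triKet (a b : Label m) :
    permW m (finRotate 3) (triKet a b) = triKet (a + b) a := by
  rw [triKet, permW_ket₃, triKet]
  congr 1
  funext k
  fin_cases k
  · rfl
  · rfl
  · change b = a + b + a
    rw [add_right_comm, label_add_self, zero_add]

theorem permW_finRotate_inv_triKet (a b : Label m) :
    permW m (finRotate 3)⁻¹ (triKet a b) = triKet b (a + b) := by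
  rw [triKet, permW_ket₃, triKet]
  congr 1
  funext k
  fin_cases k
  · rfl
  · rfl
  · change a = b + (a + b)
    rw [add_comm a b, label_add_cancel]

theorem hatKet_eq (a b : Label m) :
    hatKet a b = ((Real.sqrt 2 / 2 ^ m : ℝ) : ℂ) •
      ∑ h : Label m with symp a h = 1, sgn (symp h b) • triKet a h := rfl

theorem adjointRep_hatKet (g : cliffordGroup m) (a b : Label m) :
    adjointRep m 3 g (hatKet a b) = hatKet (labelEquiv g a) (labelEquiv g b) := by
  rw [hatKet_eq, hatKet_eq, map_smul, map_sum]
  congr 1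
  refine Finset.sum_equiv (labelEquiv g).toEquiv (fun h => ?_) fun h _ => ?_
  · simp [symp_labelEquiv]
  · simp [symp_labelEquiv, adjointRep_triKet]

theorem adjointRep_ketA (g : cliffordGroup m) (a : Label m) :
    adjointRep m 3 g (ketA a) = ketA (labelEquiv g a) := by
  rw [ketA, ketA, map_sum]
  refine Finset.sum_equiv (labelEquiv g).toEquiv (fun h => ?_) fun h _ => ?_
  · simp [symp_labelEquiv]
  · exact adjointRep_hatKet g h a

/-! ### Inner products of the vectors `|â;b⟩` -/

/-- Writing the constraint as `(1 - χ)/2` with a character `χ` turns constrained sums into full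
character sums, to which orthogonality of characters applies. -/
theorem hatKet_eq_sum (a b : Label m) :
    hatKet a b = ∑ h : Label m, (((Real.sqrt 2 / 2 ^ m : ℝ) : ℂ) *
      ((1 - sgn (symp a h)) / 2 * sgn (symp h b))) • triKet a h := by
  rw [hatKet_eq, Finset.sum_filter, Finset.smul_sum]
  refine Finset.sum_congr rfl fun h _ => ?_
  rw [← ite_eq_one_sgn]
  split_ifs <;> simp [smul_smul]

theorem hatKet_norm_sq (m : ℕ) : ((Real.sqrt 2 / 2 ^ m : ℝ) : ℂ) *
    ((Real.sqrt 2 / 2 ^ m : ℝ) : ℂ) * ((2 : ℂ) ^ m) ^ 2 = 2 := by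
  have h : (Real.sqrt 2 / 2 ^ m : ℝ) * (Real.sqrt 2 / 2 ^ m : ℝ) * ((2 : ℝ) ^ m) ^ 2 = 2 := by
    rw [div_mul_div_comm, Real.mul_self_sqrt (by norm_num), ← sq]
    exact div_mul_cancel₀ _ (by positivity)
  exact_mod_cast congrArg (fun x : ℝ => (x : ℂ)) h

theorem frob_hatKet_left (a b : Label m) (X : Op m 3) :
    frob m 3 (hatKet a b) X = ∑ h : Label m, (((Real.sqrt 2 / 2 ^ m : ℝ) : ℂ) *
      ((1 - sgn (symp a h)) / 2 * sgn (symp h b))) * frob m 3 (triKet a h) X := by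
  rw [hatKet_eq_sum, map_sum, LinearMap.sum_apply]
  refine Finset.sum_congr rfl fun h _ => ?_
  rw [LinearMap.map_smulₛₗ₂, smul_eq_mul]
  congr 1
  simp only [map_mul, map_div₀, map_sub, map_one, star_sgn, Complex.conj_ofReal, Complex.conj_ofNat]

/-- For `a = c` the constraint contributes its indicator once, which splits the sum into the
pairings of the characters of `b` and of `a + b` with that of `d`. The second term reflects `|â;b⟩ =
-|â;a+b⟩`. -/
theorem frob_hatKet (a b c d : Label m) :
    frob m 3 (hatKet a b) (hatKet c d) =
      if a = c then (if b = d then 1 else 0) - (if a + b = d then 1 else 0) else 0 := by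
  have hin : ∀ h, frob m 3 (triKet a h) (hatKet c d) = if a = c then
      (((Real.sqrt 2 / 2 ^ m : ℝ) : ℂ) * ((1 - sgn (symp c h)) / 2 * sgn (symp h d))) else 0 := by
    intro h
    rw [hatKet_eq_sum, map_sum]
    simp only [map_smul, frob_triKet, smul_eq_mul]
    split_ifs with hac
    · subst hac
      simp
    · simp [hac]
  rw [frob_hatKet_left]
  simp only [hin]
  by_cases hac : a = c
  · subst hac
    simp only [if_true]
    have key : ∀ h : Label m, (((Real.sqrt 2 / 2 ^ m : ℝ) : ℂ) *
        ((1 - sgn (symp a h)) / 2 * sgn (symp h b))) *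
        (((Real.sqrt 2 / 2 ^ m : ℝ) : ℂ) * ((1 - sgn (symp a h)) / 2 * sgn (symp h d))) =
        ((Real.sqrt 2 / 2 ^ m : ℝ) : ℂ) * ((Real.sqrt 2 / 2 ^ m : ℝ) : ℂ) / 2 *
          (sgn (symp h b) * sgn (symp h d) - sgn (symp h (a + b)) * sgn (symp h d)) := by
      intro h
      rw [symp_add_right, sgn_add, symp_comm a h]
      linear_combination ((Real.sqrt 2 / 2 ^ m : ℝ) : ℂ) * ((Real.sqrt 2 / 2 ^ m : ℝ) : ℂ) / 4 *
        sgn (symp h b) * sgn (symp h d) * sgn_mul_self (symp h a)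
    have hite : ∀ p : Prop, ∀ [Decidable p], (if p then ((2 : ℂ) ^ m) ^ 2 else 0) =
        ((2 : ℂ) ^ m) ^ 2 * if p then 1 else 0 := by
      intro p _
      split_ifs <;> simp
    simp only [key]
    rw [← Finset.mul_sum, Finset.sum_sub_distrib, sum_sgn_symp_mul, sum_sgn_symp_mul, hite, hite]
    linear_combination ((if b = d then 1 else 0) - (if a + b = d then 1 else 0)) / 2 *
      hatKet_norm_sq m
  · simp [hac]

/-- Inner products with cyclically permuted vectors. -/
theorem frob_hatKet_cycSum {a b c d : Label m} (hab : symp a b = 0) (hcd : symp c d = 0) :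
    frob m 3 (hatKet c d) (cycSum m (hatKet a b)) =
      (2 * (((Real.sqrt 2 / 2 ^ m : ℝ) : ℂ) * ((Real.sqrt 2 / 2 ^ m : ℝ) : ℂ))) *
        ((1 - sgn (symp a c)) / 2 * (sgn (symp a d) * sgn (symp c b))) := by
  have h1 : ∀ k, frob m 3 (triKet c k) (permW m (finRotate 3) (hatKet a b)) =
      if k = a then (((Real.sqrt 2 / 2 ^ m : ℝ) : ℂ) * ((1 - sgn (symp a c)) / 2 *
        sgn (symp c b))) else 0 := by
    intro k
    rw [hatKet_eq_sum, map_sum, map_sum]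
    simp only [map_smul, frob_triKet, smul_eq_mul, permW_finRotate_triKet]
    split_ifs with hk
    · rw [Finset.sum_eq_single (a + c)]
      · simp [hk, label_add_cancel, symp_add_left, symp_add_right, hab]
      · intro h _ hne
        rw [if_neg (fun e => hne (label_add_eq_iff.mp e.1.symm)), mul_zero]
      · simp
    · simp [hk]
  have h2 : ∀ k, frob m 3 (triKet c k) (permW m (finRotate 3)⁻¹ (hatKet a b)) =
      if k = a + c then (((Real.sqrt 2 / 2 ^ m : ℝ) : ℂ) * ((1 - sgn (symp a c)) / 2 *
        sgn (symp c b))) else 0 := by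
    intro k
    rw [hatKet_eq_sum, map_sum, map_sum]
    simp only [map_smul, frob_triKet, smul_eq_mul, permW_finRotate_inv_triKet]
    split_ifs with hk
    · rw [Finset.sum_eq_single c]
      · simp [hk]
      · intro h _ hne
        rw [if_neg (fun e => hne e.1.symm), mul_zero]
      · simp
    · refine Finset.sum_eq_zero fun h _ => ?_
      rw [if_neg (fun e => hk (by rw [e.2, e.1])), mul_zero]
  rw [cycSum, LinearMap.add_apply, map_add, frob_hatKet_left, frob_hatKet_left]
  simp only [h1, h2, mul_ite, mul_zero, Finset.sum_ite_eq', Finset.mem_univ, if_true]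
  rw [symp_add_right, symp_add_left, hcd, symp_self, add_zero, add_zero, symp_comm c a]
  have := sgn_mul_self (symp a c)
  linear_combination (((Real.sqrt 2 / 2 ^ m : ℝ) : ℂ) * ((Real.sqrt 2 / 2 ^ m : ℝ) : ℂ)) *
    sgn (symp a d) * sgn (symp c b) / 2 * this

theorem hatKet_eq_neg (a b : Label m) : hatKet a b = -hatKet a (a + b) := by
  rw [hatKet_eq, hatKet_eq, ← smul_neg, ← Finset.sum_neg_distrib]
  congr 1
  refine Finset.sum_congr rfl fun h hh => ?_
  rw [symp_add_right, sgn_add, symp_comm h a, (Finset.mem_filter.mp hh).2, sgn_one, neg_one_mul,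
    neg_smul, neg_neg]

/-! ### Orthogonality relations -/

/-- The vector `|â;b⟩ + |b̂;a+b⟩ + |(a+b)^;a⟩`. -/
def nullVec (a b : Label m) : Op m 3 := hatKet a b + hatKet b (a + b) + hatKet (a + b) a

/-- Each summand of the null vector gives a difference of two of the characters of `c` attached to
`a`, `b`, `a + b`. Collecting by character leaves coefficients that depend on `d` alone and vanish
for `d = 0`. -/
theorem frob_hatKet_cycSum_nullVec {a b c d : Label m} (hab : symp a b = 0) (hcd : symp c d = 0) :
    frob m 3 (hatKet c d) (cycSum m (nullVec a b)) =
      (((Real.sqrt 2 / 2 ^ m : ℝ) : ℂ) * ((Real.sqrt 2 / 2 ^ m : ℝ) : ℂ)) *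
        ((sgn (symp a d) - sgn (symp a d) * sgn (symp b d)) * sgn (symp c b) +
         (sgn (symp b d) - sgn (symp a d)) * sgn (symp c (a + b)) +
         (sgn (symp a d) * sgn (symp b d) - sgn (symp b d)) * sgn (symp c a)) := by
  have h2 : symp b (a + b) = 0 := by simp [symp_add_right, symp_comm b a, hab]
  have h3 : symp (a + b) a = 0 := by simp [symp_add_left, symp_comm b a, hab]
  rw [nullVec, map_add, map_add, map_add, map_add, frob_hatKet_cycSum hab hcd,
    frob_hatKet_cycSum h2 hcd, frob_hatKet_cycSum h3 hcd]
  simp only [symp_add_left, symp_add_right, sgn_add, symp_comm a c, symp_comm b c]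
  have ha := sgn_mul_self (symp c a)
  have hb := sgn_mul_self (symp c b)
  linear_combination (-(((Real.sqrt 2 / 2 ^ m : ℝ) : ℂ) * ((Real.sqrt 2 / 2 ^ m : ℝ) : ℂ)) *
    sgn (symp b d) * sgn (symp c a)) * hb - (((Real.sqrt 2 / 2 ^ m : ℝ) : ℂ) *
    ((Real.sqrt 2 / 2 ^ m : ℝ) : ℂ)) * sgn (symp a d) * sgn (symp b d) * sgn (symp c b) * ha

theorem frob_hatKet_zero_cycSum_nullVec {a b : Label m} (c : Label m) (hab : symp a b = 0) :
    frob m 3 (hatKet c 0) (cycSum m (nullVec a b)) = 0 := by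
  rw [frob_hatKet_cycSum_nullVec hab (symp_zero_right c)]
  simp

theorem frob_hatKet_zero_nullVec {a b : Label m} (c : Label m) (ha : a ≠ 0) (hb : b ≠ 0)
    (hne : a ≠ b) : frob m 3 (hatKet c 0) (nullVec a b) = 0 := by
  have h0 : a + b ≠ 0 := fun h => hne (label_add_eq_zero.mp h)
  simp only [nullVec, map_add, frob_hatKet, add_zero]
  rw [if_neg hb.symm, if_neg h0.symm, if_neg ha.symm]
  split_ifs <;> simp_all

theorem frob_ketA_left (x : Label m) (X : Op m 3) :
    frob m 3 (ketA x) X =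
      ∑ h : Label m with symp h x = 0 ∧ h ≠ x ∧ h ≠ 0, frob m 3 (hatKet h x) X := by
  rw [ketA, map_sum, LinearMap.sum_apply]

theorem frob_ketA_hatKet (x a b : Label m) :
    frob m 3 (ketA x) (hatKet a b) = if symp a x = 0 ∧ a ≠ x ∧ a ≠ 0 then
      (if x = b then 1 else 0) - (if a + x = b then 1 else 0) else 0 := by
  rw [frob_ketA_left]
  simp only [frob_hatKet]
  rw [Finset.sum_filter, Finset.sum_eq_single a]
  · simp
  · intro h _ hne
    simp [hne]
  · simp

/-- The three inner products are `[x = b] - [x = a + b]`, `[x = a + b] - [x = a]` and `[x = a] - [x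
= b]`, which telescope. -/
theorem frob_ketA_nullVec {a b : Label m} (x : Label m) (ha : a ≠ 0) (hb : b ≠ 0) (hne : a ≠ b)
    (hab : symp a b = 0) : frob m 3 (ketA x) (nullVec a b) = 0 := by
  have key : ∀ {a b : Label m}, a ≠ 0 → b ≠ 0 → a ≠ b → symp a b = 0 →
      frob m 3 (ketA x) (hatKet a b) = (if x = b then 1 else 0) - (if x = a + b then 1 else 0) := by
    intro a b ha hb hne hab
    rw [frob_ketA_hatKet]
    simp only [label_add_eq_iff (a := a) (b := x)]
    by_cases h1 : x = b
    · rw [if_pos ⟨h1 ▸ hab, h1 ▸ hne, ha⟩]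
    by_cases h2 : x = a + b
    · rw [if_pos]
      rw [h2]
      exact ⟨by simp [symp_add_right, hab], fun h => hb (by simpa using h), ha⟩
    · simp [h1, h2]
  have h0 : a + b ≠ 0 := fun h => hne (label_add_eq_zero.mp h)
  have h1 : b ≠ a + b := fun h => ha (by simpa using h)
  have h2 : a + b ≠ a := fun h => hb (by simpa using h)
  have e1 : b + (a + b) = a := by rw [add_comm a b, label_add_cancel]
  have e2 : a + b + a = b := by rw [add_comm, label_add_cancel]
  rw [nullVec, map_add, map_add, key ha hb hne hab,
    key hb h0 h1 (by simp [symp_add_right, symp_comm b a, hab]),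
    key h0 ha h2 (by simp [symp_add_left, symp_comm b a, hab]), e1, e2]
  ring

/-- The summand `f` is a combination of three nontrivial characters. It vanishes at `0` and at `x`,
so the exclusions in `|A(x)⟩` can be dropped. Orthogonality of characters then leaves a contribution
only for `x ∈ {a, b, a + b}`, where `p = q = 1` kills every coefficient. -/
theorem frob_ketA_cycSum_nullVec {a b : Label m} (x : Label m) (ha : a ≠ 0) (hb : b ≠ 0)
    (hne : a ≠ b) (hab : symp a b = 0) : frob m 3 (ketA x) (cycSum m (nullVec a b)) = 0 := by
  have h0 : a + b ≠ 0 := fun h => hne (label_add_eq_zero.mp h)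
  set κ : ℂ := ((Real.sqrt 2 / 2 ^ m : ℝ) : ℂ) * ((Real.sqrt 2 / 2 ^ m : ℝ) : ℂ) with hκ
  set p := sgn (symp a x) with hp
  set q := sgn (symp b x) with hq
  let f : Label m → ℂ := fun c => (p - p * q) * sgn (symp c b) +
    (q - p) * sgn (symp c (a + b)) + (p * q - q) * sgn (symp c a)
  have h1 : frob m 3 (ketA x) (cycSum m (nullVec a b)) =
      κ * ∑ h : Label m with symp h x = 0 ∧ h ≠ x ∧ h ≠ 0, f h := by
    rw [frob_ketA_left, Finset.mul_sum]
    exact Finset.sum_congr rfl fun h hh =>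
      frob_hatKet_cycSum_nullVec hab (Finset.mem_filter.mp hh).2.1
  have hf0 : f 0 = 0 := by simp [f]
  have hfx : f x = 0 := by
    simp only [f, symp_add_right, sgn_add, symp_comm x a, symp_comm x b, ← hp, ← hq]
    ring
  have h2 : ∑ h : Label m with symp h x = 0 ∧ h ≠ x ∧ h ≠ 0, f h =
      ∑ h : Label m, (1 + sgn (symp h x)) / 2 * f h := by
    rw [Finset.sum_filter]
    refine Finset.sum_congr rfl fun h _ => ?_
    rw [← ite_eq_zero_sgn]
    by_cases e : h = x
    · subst e; simp [hfx]
    by_cases e' : h = 0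
    · subst e'; simp [hf0]
    · simp [e, e']
  have h3 : ∑ h : Label m, (1 + sgn (symp h x)) / 2 * f h =
      (p - p * q) / 2 * ∑ h : Label m, (sgn (symp h b) + sgn (symp h x) * sgn (symp h b)) +
      (q - p) / 2 * ∑ h : Label m, (sgn (symp h (a + b)) + sgn (symp h x) * sgn (symp h (a + b))) +
      (p * q - q) / 2 * ∑ h : Label m, (sgn (symp h a) + sgn (symp h x) * sgn (symp h a)) := by
    simp only [Finset.mul_sum, ← Finset.sum_add_distrib, f]
    exact Finset.sum_congr rfl fun h _ => by ring
  have hba : symp b a = 0 := by rw [symp_comm, hab]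
  rw [h1, h2, h3]
  simp only [Finset.sum_add_distrib, sum_sgn_symp, sum_sgn_symp_mul, if_neg ha, if_neg hb, if_neg h0]
  have hx : x = b ∨ x = a + b ∨ x = a → p = 1 ∧ q = 1 := by
    rintro (rfl | rfl | rfl) <;> simp [hp, hq, symp_add_right, hab, hba]
  by_cases hh : x = b ∨ x = a + b ∨ x = a
  · rw [(hx hh).1, (hx hh).2]
    simp
  · push Not at hh
    simp [hh.1, hh.2.1, hh.2.2]

theorem frob_hatKet_zero_ketA {a x : Label m} (hx : x ≠ 0) :
    frob m 3 (ketA x) (hatKet a 0) = 0 := by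
  rw [frob_ketA_hatKet, if_neg hx]
  simp only [label_add_eq_zero]
  split_ifs <;> simp_all

theorem sum_ite_symp_eq_zero {x : Label m} (hx : x ≠ 0) :
    ∑ h : Label m, (if symp h x = 0 then (1 : ℂ) else 0) = ((2 : ℂ) ^ m) ^ 2 / 2 := by
  simp only [ite_eq_zero_sgn]
  rw [← Finset.sum_div, Finset.sum_add_distrib, sum_sgn_symp, if_neg hx, add_zero]
  simp [← card_label]

/-- The Gram matrix of the vectors `|A(x)⟩`. -/
theorem frob_ketA_ketA {x y : Label m} (hx : x ≠ 0) (hy : y ≠ 0) :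
    frob m 3 (ketA x) (ketA y) =
      (((2 : ℂ) ^ m) ^ 2 / 2 - 1) * (if x = y then 1 else 0) - if symp x y = 0 then 1 else 0 := by
  have h1 : frob m 3 (ketA x) (ketA y) = ∑ h : Label m, if symp h y = 0 ∧ h ≠ y ∧ h ≠ 0 then
      (if symp h x = 0 ∧ h ≠ x ∧ h ≠ 0 then
      (if x = y then 1 else 0) - (if h + x = y then 1 else 0) else 0) else 0 := by
    conv_lhs => rw [ketA.eq_1 y]
    rw [map_sum, Finset.sum_filter]
    simp only [frob_ketA_hatKet]
  rw [h1]
  -- On the diagonal each admissible `h` contributes one, in total `N²/2 - 2`; off the diagonal only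
  -- `h = x + y` can contribute.
  by_cases hxy : x = y
  · subst hxy
    have h2 : ∀ h : Label m, (if symp h x = 0 ∧ h ≠ x ∧ h ≠ 0 then
        (if symp h x = 0 ∧ h ≠ x ∧ h ≠ 0 then
        (if x = x then (1 : ℂ) else 0) - (if h + x = x then 1 else 0) else 0) else 0) =
        (if symp h x = 0 then 1 else 0) - (if h = x then 1 else 0) - (if h = 0 then 1 else 0) := by
      intro h
      by_cases e : h = x
      · subst e; simp [hx]
      by_cases e' : h = 0
      · subst e'; simp [hx.symm]
      · simp [e, e']
    rw [Finset.sum_congr rfl fun h _ => h2 h, Finset.sum_sub_distrib, Finset.sum_sub_distrib,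
      sum_ite_symp_eq_zero hx]
    simp
  · rw [Finset.sum_eq_single (x + y)]
    · have e1 : x + y + x = y := by rw [add_comm, label_add_cancel]
      simp [symp_add_left, hxy, e1, hx, hy, symp_comm y x, label_add_eq_zero]
      split_ifs <;> simp
    · intro h _ hne
      have : ¬ h + x = y := fun e => hne (by
        rw [add_comm] at e
        exact label_add_eq_iff.mp e)
      simp [hxy, this]
    · simp

/-! ### The permutation representation on coefficient families -/

/-- The permutation of the nonzero labels induced by a Clifford unitary. -/
def nzEquiv (g : cliffordGroup m) : NZLabel m ≃ NZLabel m :=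
  (labelEquiv g).toEquiv.subtypeEquiv fun a => by
    change a ≠ 0 ↔ labelEquiv g a ≠ 0
    simp

theorem coe_nzEquiv (g : cliffordGroup m) (x : NZLabel m) :
    (nzEquiv g x : Label m) = labelEquiv g x.1 := rfl

theorem nzEquiv_one (x : NZLabel m) : nzEquiv (1 : cliffordGroup m) x = x :=
  Subtype.ext (labelEquiv_one x.1)

theorem nzEquiv_mul (g h : cliffordGroup m) (x : NZLabel m) :
    nzEquiv (g * h) x = nzEquiv g (nzEquiv h x) :=
  Subtype.ext (labelEquiv_mul g h x.1)

theorem nzEquiv_inv_apply_self (g : cliffordGroup m) (x : NZLabel m) :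
    nzEquiv g⁻¹ (nzEquiv g x) = x := by
  rw [← nzEquiv_mul, inv_mul_cancel, nzEquiv_one]

theorem nzEquiv_apply_inv_self (g : cliffordGroup m) (x : NZLabel m) :
    nzEquiv g (nzEquiv g⁻¹ x) = x := by
  rw [← nzEquiv_mul, mul_inv_cancel, nzEquiv_one]

/-- The permutation representation of the Clifford group on functions on nonzero labels. -/
def permRep (m : ℕ) : Representation ℂ (cliffordGroup m) (NZLabel m → ℂ) where
  toFun g := LinearMap.funLeft ℂ ℂ (nzEquiv g⁻¹)
  map_one' := by
    refine LinearMap.ext fun l => funext fun x => ?_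
    simp [LinearMap.funLeft_apply, nzEquiv_one]
  map_mul' g h := by
    refine LinearMap.ext fun l => funext fun x => ?_
    simp [LinearMap.funLeft_apply, nzEquiv_mul]

theorem permRep_apply (g : cliffordGroup m) (l : NZLabel m → ℂ) (x : NZLabel m) :
    permRep m g l x = l (nzEquiv g⁻¹ x) := rfl

theorem permRep_single (g : cliffordGroup m) (y : NZLabel m) :
    permRep m g (Pi.single y 1) = Pi.single (nzEquiv g y) 1 := by
  funext x
  rw [permRep_apply, Pi.single_apply, Pi.single_apply]
  congr 1
  refine propext ⟨fun h => ?_, fun h => ?_⟩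
  · rw [← h, nzEquiv_apply_inv_self]
  · rw [h, nzEquiv_inv_apply_self]

/-- The linear map `λ ↦ ∑_x λ_x v_x`. -/
def comb {t : ℕ} (v : Label m → Op m t) : (NZLabel m → ℂ) →ₗ[ℂ] Op m t :=
  Fintype.linearCombination ℂ fun x : NZLabel m => v x.1

theorem comb_apply {t : ℕ} (v : Label m → Op m t) (l : NZLabel m → ℂ) :
    comb v l = ∑ x, l x • v x.1 := rfl

/-- A family of operators that the Clifford group permutes through its action on labels. -/
def IsEquivariant {t : ℕ} (v : Label m → Op m t) : Prop :=
  ∀ g a, adjointRep m t g (v a) = v (labelEquiv g a)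

theorem IsEquivariant.adjointRep_comb {t : ℕ} {v : Label m → Op m t} (hv : IsEquivariant v)
    (g : cliffordGroup m) (l : NZLabel m → ℂ) :
    adjointRep m t g (comb v l) = comb v (permRep m g l) := by
  rw [comb_apply, comb_apply, map_sum]
  refine Fintype.sum_equiv (nzEquiv g) _ _ fun x => ?_
  rw [map_smul, hv, permRep_apply, nzEquiv_inv_apply_self]
  rfl

/-- The space `Λ_s` of coefficient families. -/
def coeffSpace (m : ℕ) (s : ℂ) : Submodule ℂ (NZLabel m → ℂ) where
  carrier := {l | IsCoeff s l}
  zero_mem' := by simp [IsCoeff]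
  add_mem' := by
    rintro l k ⟨h1, h2⟩ ⟨h3, h4⟩
    refine ⟨by simp [Finset.sum_add_distrib, h1, h3], fun x => ?_⟩
    simp only [Pi.add_apply, Finset.sum_add_distrib, h2, h4, mul_add]
  smul_mem' := by
    rintro c l ⟨h1, h2⟩
    refine ⟨by simp [← Finset.mul_sum, h1], fun x => ?_⟩
    simp only [Pi.smul_apply, smul_eq_mul, ← Finset.mul_sum, h2]
    ring

/-- The orthogonality operator `λ ↦ (x ↦ ∑_{y : ⟨y,x⟩ = 0} λ_y)`. -/
def perpOp (m : ℕ) : Module.End ℂ (NZLabel m → ℂ) where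
  toFun l x := ∑ y : NZLabel m, (if symp y.1 x.1 = 0 then 1 else 0) * l y
  map_add' l k := by funext x; simp [mul_add, Finset.sum_add_distrib]
  map_smul' c l := by
    funext x
    simp only [Pi.smul_apply, smul_eq_mul, RingHom.id_apply, Finset.mul_sum]
    exact Finset.sum_congr rfl fun y _ => by ring

theorem perpOp_apply (l : NZLabel m → ℂ) (x : NZLabel m) :
    perpOp m l x = ∑ y : NZLabel m, (if symp y.1 x.1 = 0 then 1 else 0) * l y := rfl

theorem mem_coeffSpace {s : ℂ} {l : NZLabel m → ℂ} :
    l ∈ coeffSpace m s ↔ ∑ x, l x = 0 ∧ perpOp m l = (s * ((2 : ℂ) ^ m / 2)) • l := by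
  change IsCoeff s l ↔ _
  rw [IsCoeff, funext_iff]
  simp [perpOp_apply, Finset.sum_filter]

theorem perpOp_permRep (g : cliffordGroup m) (l : NZLabel m → ℂ) :
    perpOp m (permRep m g l) = permRep m g (perpOp m l) := by
  funext x
  rw [perpOp_apply, permRep_apply, perpOp_apply]
  refine Fintype.sum_equiv (nzEquiv g⁻¹) _ _ fun y => ?_
  rw [permRep_apply, coe_nzEquiv, coe_nzEquiv, symp_labelEquiv]

theorem sum_permRep (g : cliffordGroup m) (l : NZLabel m → ℂ) :
    ∑ x, permRep m g l x = ∑ x, l x :=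
  Equiv.sum_comp (nzEquiv g⁻¹) l

/-- Invariance under the permutation representation. -/
def IsPermInv (K : Submodule ℂ (NZLabel m → ℂ)) : Prop :=
  ∀ g : cliffordGroup m, K ≤ K.comap (permRep m g)

theorem isPermInv_coeffSpace (m : ℕ) (s : ℂ) : IsPermInv (coeffSpace m s) := by
  intro g l hl
  rw [mem_coeffSpace] at hl
  rw [Submodule.mem_comap, mem_coeffSpace]
  exact ⟨by rw [sum_permRep, hl.1], by rw [perpOp_permRep, hl.2, map_smul]⟩

theorem isPermInv_top (m : ℕ) : IsPermInv (⊤ : Submodule ℂ (NZLabel m → ℂ)) :=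
  fun _ _ _ => trivial

theorem isPermInv_span_one (m : ℕ) :
    IsPermInv (Submodule.span ℂ {(1 : NZLabel m → ℂ)}) := by
  intro g l hl
  obtain ⟨c, rfl⟩ := Submodule.mem_span_singleton.mp hl
  exact Submodule.mem_span_singleton.mpr ⟨c, rfl⟩

theorem sum_nzLabel (f : Label m → ℂ) : ∑ x : NZLabel m, f x.1 = (∑ x, f x) - f 0 := by
  rw [Fintype.sum_eq_add_sum_subtype_ne f 0]
  ring

theorem sum_ite_symp_nzLabel (x : NZLabel m) :
    ∑ y : NZLabel m, (if symp y.1 x.1 = 0 then (1 : ℂ) else 0) = ((2 : ℂ) ^ m) ^ 2 / 2 - 1 := by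
  rw [sum_nzLabel fun y => if symp y x.1 = 0 then (1 : ℂ) else 0, sum_ite_symp_eq_zero x.2]
  simp

theorem perpOp_one (m : ℕ) : perpOp m 1 = (((2 : ℂ) ^ m) ^ 2 / 2 - 1) • 1 := by
  funext x
  simp [perpOp_apply, ← sum_ite_symp_nzLabel x]

theorem sum_perpOp (l : NZLabel m → ℂ) :
    ∑ x, perpOp m l x = (((2 : ℂ) ^ m) ^ 2 / 2 - 1) * ∑ x, l x := by
  simp only [perpOp_apply]
  rw [Finset.sum_comm, Finset.mul_sum]
  refine Finset.sum_congr rfl fun y _ => ?_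
  rw [← Finset.sum_mul, ← sum_ite_symp_nzLabel y]
  simp only [symp_comm y.1]

/-- This counts the labels orthogonal to both `x` and `y`: `N²/2` if they coincide, `N²/4`
otherwise, minus the zero label. -/
theorem sum_ite_symp_mul_ite_symp (x y : NZLabel m) :
    ∑ z : NZLabel m, (if symp z.1 x.1 = 0 then (1 : ℂ) else 0) *
      (if symp y.1 z.1 = 0 then 1 else 0) =
      ((2 : ℂ) ^ m) ^ 2 / 4 * (1 + if y = x then 1 else 0) - 1 := by
  rw [sum_nzLabel fun z => (if symp z x.1 = 0 then (1 : ℂ) else 0) *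
      (if symp y.1 z = 0 then 1 else 0)]
  simp only [ite_eq_zero_sgn, symp_zero_left, symp_zero_right]
  have h : ∀ z : Label m, (1 + sgn (symp z x.1)) / 2 * ((1 + sgn (symp y.1 z)) / 2) =
      (1 + sgn (symp z x.1) + sgn (symp z y.1) + sgn (symp z y.1) * sgn (symp z x.1)) / 4 := by
    intro z
    rw [symp_comm y.1 z]
    ring
  simp only [h]
  rw [← Finset.sum_div, Finset.sum_add_distrib, Finset.sum_add_distrib, Finset.sum_add_distrib,
    sum_sgn_symp, sum_sgn_symp, sum_sgn_symp_mul, if_neg x.2, if_neg y.2]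
  simp only [Subtype.ext_iff, Finset.sum_const, Finset.card_univ, nsmul_eq_mul, card_label]
  split_ifs <;> ring

/-- The count of common orthogonal labels says that the square is `N²/4` times the identity plus a
multiple of the all-ones matrix, which kills zero-sum functions. -/
theorem perpOp_perpOp {l : NZLabel m → ℂ} (hl : ∑ x, l x = 0) :
    perpOp m (perpOp m l) = (((2 : ℂ) ^ m) ^ 2 / 4) • l := by
  funext x
  simp only [perpOp_apply, Finset.mul_sum, Pi.smul_apply, smul_eq_mul]
  rw [Finset.sum_comm]
  simp only [← mul_assoc]
  have h : ∀ y : NZLabel m, ∑ z : NZLabel m, (if symp z.1 x.1 = 0 then (1 : ℂ) else 0) *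
      (if symp y.1 z.1 = 0 then 1 else 0) * l y =
      (((2 : ℂ) ^ m) ^ 2 / 4 - 1) * l y +
        ((2 : ℂ) ^ m) ^ 2 / 4 * ((if y = x then 1 else 0) * l y) := by
    intro y
    rw [← Finset.sum_mul, sum_ite_symp_mul_ite_symp]
    ring
  simp only [h, Finset.sum_add_distrib, ← Finset.mul_sum, hl]
  simp

/-- On zero-sum functions `(perpOp - sN/2)(perpOp + sN/2) = 0`, so the second factor maps into
`Λ_s`. It serves both to show `Λ_s ≠ 0` and to decompose functions. -/
theorem perpOp_add_mem_coeffSpace {l : NZLabel m → ℂ} (hl : ∑ x, l x = 0) {s : ℂ}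
    (hs : s * s = 1) : perpOp m l + (s * ((2 : ℂ) ^ m / 2)) • l ∈ coeffSpace m s := by
  rw [mem_coeffSpace]
  constructor
  · simp [Finset.sum_add_distrib, sum_perpOp, ← Finset.mul_sum, hl]
  · rw [map_add, map_smul, perpOp_perpOp hl, smul_add, smul_smul, add_comm]
    congr 2
    linear_combination -((2 : ℂ) ^ m) ^ 2 / 4 * hs

/-! ### Equivariant operators -/

theorem eq_sum_smul_single (l : NZLabel m → ℂ) : l = ∑ y, l y • Pi.single y (1 : ℂ) := by
  funext x
  simp [Finset.sum_apply, Pi.single_apply]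

/-- An operator that commutes with the Clifford group is a combination of the identity, the
orthogonality operator and the sum. -/
theorem exists_coeffs_of_commute {Q : Module.End ℂ (NZLabel m → ℂ)}
    (hQ : ∀ g l, Q (permRep m g l) = permRep m g (Q l)) :
    ∃ a b c : ℂ, ∀ l x, Q l x = a * l x + b * perpOp m l x + c * ∑ y, l y := by
  classical
  -- The matrix of `Q`, extended by zero to all labels so that the transvection lemmas apply to it.
  let q : Label m → Label m → ℂ := fun x y =>
    if hx : x ≠ 0 then if hy : y ≠ 0 then Q (Pi.single ⟨y, hy⟩ 1) ⟨x, hx⟩ else 0 else 0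
  have hqnz : ∀ x y : NZLabel m, q x.1 y.1 = Q (Pi.single y 1) x := fun x y => by
    simp only [q]
    rw [dif_pos x.2, dif_pos y.2]
  have hq : ∀ v x y, q (transvection v x) (transvection v y) = q x y := by
    intro v x y
    by_cases hx : x = 0
    · subst hx
      simp [q, transvection_zero]
    by_cases hy : y = 0
    · subst hy
      simp [q, transvection_zero]
    have hT : ∀ z : NZLabel m, transvection v z.1 = (nzEquiv (transvectionClifford v) z).1 :=
      fun z => (labelEquiv_transvectionClifford v z.1).symm
    rw [hT ⟨x, hx⟩, hT ⟨y, hy⟩, hqnz, ← permRep_single, hQ, permRep_apply, nzEquiv_inv_apply_self]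
    exact (hqnz ⟨x, hx⟩ ⟨y, hy⟩).symm
  obtain ⟨α, hα⟩ := exists_diag_value hq
  obtain ⟨β, hβ⟩ := exists_offdiag_value hq 0
  obtain ⟨γ, hγ⟩ := exists_offdiag_value hq 1
  -- The entry is `α` for equal, `β` for distinct orthogonal and `γ` for non-orthogonal labels.
  have hval : ∀ x y : NZLabel m, Q (Pi.single y 1) x = (α - β) * (if y = x then 1 else 0) +
      (β - γ) * (if symp y.1 x.1 = 0 then 1 else 0) + γ := by
    intro x y
    rw [← hqnz]
    by_cases hxy : y = x
    · subst hxy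
      simp [hα y.1 y.2]
    have hne : x.1 ≠ y.1 := fun h => hxy (Subtype.ext h.symm)
    rcases zmod_two_cases (symp x.1 y.1) with h | h
    · rw [hβ x.1 y.1 x.2 y.2 hne h, symp_comm, h]
      simp [hxy]
    · rw [hγ x.1 y.1 x.2 y.2 hne h, symp_comm, h]
      simp [hxy]
  refine ⟨α - β, β - γ, γ, fun l x => ?_⟩
  conv_lhs => rw [eq_sum_smul_single l]
  rw [map_sum, Finset.sum_apply]
  simp only [map_smul, Pi.smul_apply, smul_eq_mul, hval, perpOp_apply, Finset.mul_sum]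
  have h1 : (α - β) * l x = ∑ y : NZLabel m, (α - β) * ((if y = x then 1 else 0) * l y) := by
    simp
  rw [h1, ← Finset.sum_add_distrib, ← Finset.sum_add_distrib]
  exact Finset.sum_congr rfl fun y _ => by ring

/-- The orthogonal projection onto an invariant subspace is equivariant. -/
theorem exists_equivariant_projection {K : Submodule ℂ (NZLabel m → ℂ)} (hK : IsPermInv K) :
    ∃ P : Module.End ℂ (NZLabel m → ℂ), (∀ l, P l ∈ K) ∧ (∀ l ∈ K, P l = l) ∧
      ∀ g l, P (permRep m g l) = permRep m g (P l) := by
  let e : EuclideanSpace ℂ (NZLabel m) ≃ₗ[ℂ] (NZLabel m → ℂ) := WithLp.linearEquiv 2 ℂ _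
  let K' : Submodule ℂ (EuclideanSpace ℂ (NZLabel m)) := K.comap e.toLinearMap
  have hmem : ∀ u, e (K'.starProjection u) ∈ K := fun u => K'.starProjection_apply_mem u
  refine ⟨e.toLinearMap ∘ₗ K'.starProjection.toLinearMap ∘ₗ e.symm.toLinearMap,
    fun l => hmem _, fun l hl => ?_, fun g l => ?_⟩
  · have : K'.starProjection (e.symm l) = e.symm l :=
      Submodule.starProjection_eq_self_iff.mpr (by simpa [K'] using hl)
    simp [this]
  -- The translate of the projection lies in `K`, and the translated residual is orthogonal to `K`
  -- because `g` permutes coordinates and `g⁻¹` preserves `K`.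
  · have h : K'.starProjection (e.symm (permRep m g l)) =
        e.symm (permRep m g (e (K'.starProjection (e.symm l)))) := by
      refine Submodule.eq_starProjection_of_mem_of_inner_eq_zero ?_ fun w hw => ?_
      · change e (e.symm _) ∈ K
        rw [LinearEquiv.apply_symm_apply]
        exact hK g (hmem _)
      · have hw' : e.symm (permRep m g⁻¹ (e w)) ∈ K' := by
          change e (e.symm _) ∈ K
          rw [LinearEquiv.apply_symm_apply]
          exact hK g⁻¹ hw
        have h0 := K'.starProjection_inner_eq_zero (e.symm l) _ hw'
        rw [← h0, PiLp.inner_apply, PiLp.inner_apply]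
        refine Fintype.sum_equiv (nzEquiv g⁻¹) _ _ fun x => ?_
        change inner ℂ (l (nzEquiv g⁻¹ x) - e (K'.starProjection (e.symm l)) (nzEquiv g⁻¹ x))
          (e w x) = inner ℂ (l (nzEquiv g⁻¹ x) - e (K'.starProjection (e.symm l)) (nzEquiv g⁻¹ x))
          (e w (nzEquiv g⁻¹⁻¹ (nzEquiv g⁻¹ x)))
        rw [nzEquiv_inv_apply_self]
    change e (K'.starProjection (e.symm (permRep m g l))) = _
    rw [h, LinearEquiv.apply_symm_apply]
    rfl

/-! ### Irreducibility and inequivalence in the permutation representation -/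

/-- Every vector of `K` is an eigenvector of the orthogonality operator and of the sum, with
eigenvalues that do not depend on the vector. -/
def IsEig (K : Submodule ℂ (NZLabel m → ℂ)) : Prop :=
  ∃ α β : ℂ, ∀ l ∈ K, perpOp m l = α • l ∧ ∀ x, ∑ y, l y = β * l x

theorem isEig_coeffSpace (m : ℕ) (s : ℂ) : IsEig (coeffSpace m s) :=
  ⟨s * ((2 : ℂ) ^ m / 2), 0, fun l hl => by
    rw [mem_coeffSpace] at hl
    exact ⟨hl.2, fun x => by rw [hl.1, zero_mul]⟩⟩

theorem isEig_span_one (m : ℕ) : IsEig (Submodule.span ℂ {(1 : NZLabel m → ℂ)}) := by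
  refine ⟨((2 : ℂ) ^ m) ^ 2 / 2 - 1, Fintype.card (NZLabel m), fun l hl => ?_⟩
  obtain ⟨c, rfl⟩ := Submodule.mem_span_singleton.mp hl
  refine ⟨by rw [map_smul, perpOp_one, smul_comm], fun x => ?_⟩
  simp

/-- An equivariant operator acts as a scalar on a common eigenspace. -/
theorem IsEig.exists_scalar {K : Submodule ℂ (NZLabel m → ℂ)} (hK : IsEig K)
    {Q : Module.End ℂ (NZLabel m → ℂ)} (hQ : ∀ g l, Q (permRep m g l) = permRep m g (Q l)) :
    ∃ c : ℂ, ∀ l ∈ K, Q l = c • l := by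
  obtain ⟨α, β, h⟩ := hK
  obtain ⟨a, b, c, hq⟩ := exists_coeffs_of_commute hQ
  refine ⟨a + b * α + c * β, fun l hl => funext fun x => ?_⟩
  rw [hq, (h l hl).1, (h l hl).2 x]
  simp only [Pi.smul_apply, smul_eq_mul]
  ring

/-- The representation on an invariant space of coefficient families. -/
abbrev permSubrep {K : Submodule ℂ (NZLabel m → ℂ)} (hK : IsPermInv K) :
    Representation ℂ (cliffordGroup m) K :=
  (permRep m).subrepresentation K hK

/-- The orthogonal projection onto an invariant subspace of `K` is equivariant, hence a scalar `c`
on `K`. For `c = 0` the subspace is zero; otherwise every vector of `K` is a multiple of its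
projection. -/
theorem IsEig.isIrreducible {K : Submodule ℂ (NZLabel m → ℂ)} (hE : IsEig K) (hK : IsPermInv K)
    (h0 : K ≠ ⊥) : (permSubrep hK).IsIrreducible := by
  have hnt : Nontrivial (Subrepresentation (permSubrep hK)) := by
    refine ⟨⊥, ⊤, fun h => h0 ((Submodule.eq_bot_iff K).mpr fun l hl => ?_)⟩
    have h1 : (⟨l, hl⟩ : K) ∈ (⊥ : Subrepresentation (permSubrep hK)).toSubmodule := by
      rw [h]; exact Submodule.mem_top
    exact congrArg Subtype.val ((Submodule.mem_bot ℂ).mp h1)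
  refine { eq_bot_or_eq_top := fun W => ?_ }
  have hW : IsPermInv (W.toSubmodule.map K.subtype) := by
    rintro g _ ⟨l, hl, rfl⟩
    exact ⟨permSubrep hK g l, W.apply_mem_toSubmodule g hl, rfl⟩
  obtain ⟨P, hP1, hP2, hP3⟩ := exists_equivariant_projection hW
  obtain ⟨c, hc⟩ := hE.exists_scalar hP3
  by_cases hc0 : c = 0
  · left
    refine Subrepresentation.toSubmodule_injective ((Submodule.eq_bot_iff _).mpr fun l hl => ?_)
    have h1 := hP2 l.1 ⟨l, hl, rfl⟩
    rw [hc l.1 l.2, hc0, zero_smul] at h1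
    exact Subtype.ext h1.symm
  · right
    refine Subrepresentation.toSubmodule_injective (Submodule.eq_top_iff'.mpr fun l => ?_)
    obtain ⟨k, hk, hkl⟩ := hP1 l.1
    rw [hc l.1 l.2] at hkl
    have h2 : l = c⁻¹ • k := by
      refine Subtype.ext ?_
      have : (k : NZLabel m → ℂ) = c • l.1 := hkl
      rw [Submodule.coe_smul, this, smul_smul, inv_mul_cancel₀ hc0, one_smul]
    rw [h2]
    exact W.toSubmodule.smul_mem _ hk

/-- An isomorphism `K → L`, precomposed with the projection onto `K`, is an equivariant operator on
the whole space and so a scalar on `K`. It maps `K` into `K ∩ L = 0`, contradicting injectivity. -/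
theorem IsEig.not_equiv {K L : Submodule ℂ (NZLabel m → ℂ)} (hE : IsEig K) (hK : IsPermInv K)
    (hL : IsPermInv L) (h0 : K ≠ ⊥) (hKL : Disjoint K L) :
    ¬ Nonempty ((permSubrep hK).Equiv (permSubrep hL)) := by
  rintro ⟨φ⟩
  obtain ⟨P, hP1, hP2, hP3⟩ := exists_equivariant_projection hK
  let Q : Module.End ℂ (NZLabel m → ℂ) :=
    L.subtype ∘ₗ φ.toLinearEquiv.toLinearMap ∘ₗ P.codRestrict K hP1
  have hQl : ∀ l, Q l = (φ ⟨P l, hP1 l⟩ : NZLabel m → ℂ) := fun l => rfl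
  have hQ : ∀ g l, Q (permRep m g l) = permRep m g (Q l) := by
    intro g l
    have h1 : (⟨P (permRep m g l), hP1 _⟩ : K) = permSubrep hK g ⟨P l, hP1 l⟩ :=
      Subtype.ext (hP3 g l)
    have h2 : φ (permSubrep hK g ⟨P l, hP1 l⟩) = permSubrep hL g (φ ⟨P l, hP1 l⟩) :=
      LinearMap.congr_fun (φ.isIntertwining' g) _
    rw [hQl, h1, h2, hQl]
    rfl
  obtain ⟨c, hc⟩ := hE.exists_scalar hQ
  refine h0 ((Submodule.eq_bot_iff K).mpr fun l hl => ?_)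
  have h1 : Q l = 0 := by
    refine (Submodule.disjoint_def.mp hKL) _ ?_ ?_
    · rw [hc l hl]
      exact K.smul_mem c hl
    · rw [hQl]
      exact Subtype.coe_prop _
  have h2 : φ ⟨P l, hP1 l⟩ = 0 := Subtype.ext h1
  have h3 : (⟨P l, hP1 l⟩ : K) = 0 := φ.toLinearEquiv.map_eq_zero_iff.mp h2
  rw [← hP2 l hl]
  exact congrArg Subtype.val h3

theorem isIrreducible_of_equiv {G V W : Type*} [Group G] [AddCommGroup V] [Module ℂ V]
    [AddCommGroup W] [Module ℂ W] {ρ : Representation ℂ G V} {σ : Representation ℂ G W}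
    (φ : ρ.Equiv σ) (h : ρ.IsIrreducible) : σ.IsIrreducible := by
  have hφ : ∀ g v, φ (ρ g v) = σ g (φ v) := fun g v => LinearMap.congr_fun (φ.isIntertwining' g) v
  have hnt : Nontrivial (Subrepresentation σ) := by
    refine ⟨⊥, ⊤, fun e => ?_⟩
    refine bot_ne_top (α := Subrepresentation ρ)
      (Subrepresentation.toSubmodule_injective (Submodule.ext fun v => ?_))
    refine ⟨fun _ => trivial, fun _ => ?_⟩
    have h1 : φ v ∈ (⊥ : Subrepresentation σ).toSubmodule := by
      rw [e]; exact Submodule.mem_top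
    exact (Submodule.mem_bot ℂ).mpr
      (φ.toLinearEquiv.map_eq_zero_iff.mp ((Submodule.mem_bot ℂ).mp h1))
  refine { eq_bot_or_eq_top := fun W => ?_ }
  let W' : Subrepresentation ρ :=
    ⟨W.toSubmodule.comap φ.toLinearEquiv.toLinearMap, fun g v hv => by
      change φ (ρ g v) ∈ W.toSubmodule
      rw [hφ]
      exact W.apply_mem_toSubmodule g hv⟩
  have hmem : ∀ w, φ.symm w ∈ W'.toSubmodule ↔ w ∈ W.toSubmodule := fun w => by
    change φ (φ.symm w) ∈ W.toSubmodule ↔ _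
    rw [φ.apply_symm_apply]
  rcases h.eq_bot_or_eq_top W' with e | e
  · left
    refine Subrepresentation.toSubmodule_injective ((Submodule.eq_bot_iff _).mpr fun w hw => ?_)
    have h1 := (hmem w).mpr hw
    rw [e] at h1
    have h2 : φ.symm w = 0 := (Submodule.mem_bot ℂ).mp h1
    rw [← φ.apply_symm_apply w, h2]
    exact map_zero φ.toLinearEquiv
  · right
    refine Subrepresentation.toSubmodule_injective (Submodule.eq_top_iff'.mpr fun w => ?_)
    rw [← hmem, e]
    exact Submodule.mem_top

/-! ### Transfer to operators -/

theorem IsEquivariant.isInv_map {t : ℕ} {v : Label m → Op m t} (hv : IsEquivariant v)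
    {K : Submodule ℂ (NZLabel m → ℂ)} (hK : IsPermInv K) : IsInv (K.map (comb v)) := by
  rintro g _ ⟨l, hl, rfl⟩
  exact ⟨permRep m g l, hK g hl, (hv.adjointRep_comb g l).symm⟩

/-- The restriction of `comb v` to an invariant subspace on which it is injective. -/
def combEquiv {t : ℕ} {v : Label m → Op m t} (hv : IsEquivariant v)
    {K : Submodule ℂ (NZLabel m → ℂ)} (hK : IsPermInv K)
    (hinj : ∀ l ∈ K, comb v l = 0 → l = 0) :
    (permSubrep hK).Equiv (subrep (hv.isInv_map hK)) :=
  Representation.Equiv.mk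
    (LinearEquiv.ofBijective ((comb v).restrict fun l hl => Submodule.mem_map_of_mem hl)
      ⟨(injective_iff_map_eq_zero _).mpr fun l hl =>
          Subtype.ext (hinj l.1 l.2 (congrArg Subtype.val hl)), by
        rintro ⟨_, l, hl, rfl⟩
        exact ⟨⟨l, hl⟩, rfl⟩⟩)
    fun g => LinearMap.ext fun l => Subtype.ext (hv.adjointRep_comb g l.1).symm

theorem carriesIrrep_map {t : ℕ} {v : Label m → Op m t} (hv : IsEquivariant v)
    {K : Submodule ℂ (NZLabel m → ℂ)} (hE : IsEig K) (hK : IsPermInv K) (h0 : K ≠ ⊥)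
    (hinj : ∀ l ∈ K, comb v l = 0 → l = 0) : CarriesIrrep (K.map (comb v)) :=
  ⟨hv.isInv_map hK, isIrreducible_of_equiv (combEquiv hv hK hinj) (hE.isIrreducible hK h0)⟩

theorem equivalentReps_map {t t' : ℕ} {v : Label m → Op m t} {w : Label m → Op m t'}
    (hv : IsEquivariant v) (hw : IsEquivariant w) {K : Submodule ℂ (NZLabel m → ℂ)}
    (hK : IsPermInv K) (hinjv : ∀ l ∈ K, comb v l = 0 → l = 0)
    (hinjw : ∀ l ∈ K, comb w l = 0 → l = 0) :
    EquivalentReps (K.map (comb v)) (K.map (comb w)) :=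
  ⟨hv.isInv_map hK, hw.isInv_map hK,
    ⟨(combEquiv hv hK hinjv).symm.trans (combEquiv hw hK hinjw)⟩⟩

theorem not_equivalentReps_map {t : ℕ} {v : Label m → Op m t} (hv : IsEquivariant v)
    {K L : Submodule ℂ (NZLabel m → ℂ)} (hE : IsEig K) (hK : IsPermInv K) (hL : IsPermInv L)
    (h0 : K ≠ ⊥) (hKL : Disjoint K L) (hinj : ∀ l, comb v l = 0 → l = 0) :
    ¬ EquivalentReps (K.map (comb v)) (L.map (comb v)) := by
  rintro ⟨_, _, ⟨φ⟩⟩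
  exact hE.not_equiv hK hL h0 hKL
    ⟨((combEquiv hv hK fun l _ => hinj l).trans φ).trans (combEquiv hv hL fun l _ => hinj l).symm⟩

theorem eigSpan_eq_map {t : ℕ} (s : ℂ) (v : Label m → Op m t) :
    eigSpan s v = (coeffSpace m s).map (comb v) := by
  refine le_antisymm (Submodule.span_le.mpr ?_) ?_
  · rintro _ ⟨l, hl, rfl⟩
    exact ⟨l, hl, rfl⟩
  · rintro _ ⟨l, hl, rfl⟩
    exact Submodule.subset_span ⟨l, hl, rfl⟩

theorem sumLine_eq_map {t : ℕ} (v : Label m → Op m t) :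
    sumLine v = (Submodule.span ℂ {(1 : NZLabel m → ℂ)}).map (comb v) := by
  rw [Submodule.map_span, Set.image_singleton, sumLine, comb_apply]
  simp

theorem span_nonzero_eq_map {t : ℕ} (v : Label m → Op m t) :
    Submodule.span ℂ {X | ∃ a : Label m, a ≠ 0 ∧ X = v a} =
      (⊤ : Submodule ℂ (NZLabel m → ℂ)).map (comb v) := by
  rw [Submodule.map_top, comb, Fintype.range_linearCombination]
  congr 1
  ext X
  constructor
  · rintro ⟨a, ha, rfl⟩
    exact ⟨⟨a, ha⟩, rfl⟩
  · rintro ⟨a, rfl⟩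
    exact ⟨a.1, a.2, rfl⟩

theorem frob_comb_right {t : ℕ} (v : Label m → Op m t) (X : Op m t) (l : NZLabel m → ℂ) :
    frob m t X (comb v l) = ∑ x, l x * frob m t X (v x.1) := by
  simp [comb_apply, map_sum]

theorem comb_eq_zero_of_orthonormal {t : ℕ} {v : Label m → Op m t}
    (hv : ∀ x y : NZLabel m, frob m t (v x.1) (v y.1) = if x = y then 1 else 0)
    (l : NZLabel m → ℂ) (h : comb v l = 0) : l = 0 := by
  funext x
  have h1 := frob_comb_right v (v x.1) l
  rw [h, map_zero] at h1
  simpa [hv] using h1.symm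

/-! ### The three families of vectors -/

theorem isEquivariant_ket₂ : IsEquivariant (ket₂ : Label m → Op m 2) := adjointRep_ket₂

theorem isEquivariant_hatKet : IsEquivariant (fun a : Label m => hatKet a 0) := fun g a => by
  rw [adjointRep_hatKet, map_zero]

theorem isEquivariant_ketA : IsEquivariant (ketA : Label m → Op m 3) := adjointRep_ketA

theorem comb_ket₂_injective (l : NZLabel m → ℂ) (h : comb ket₂ l = 0) : l = 0 :=
  comb_eq_zero_of_orthonormal (fun x y => by rw [frob_ket₂]; simp [Subtype.ext_iff]) l h

theorem comb_hatKet_injective (l : NZLabel m → ℂ)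
    (h : comb (fun a : Label m => hatKet a 0) l = 0) : l = 0 :=
  comb_eq_zero_of_orthonormal (fun x y => by
    rw [frob_hatKet]
    simp [Subtype.ext_iff, x.2]) l h

/-- The Gram matrix `(N²/2 - 1) - perpOp` acts on `Λ_s` as a scalar. -/
theorem frob_ketA_comb {s : ℂ} {l : NZLabel m → ℂ} (hl : l ∈ coeffSpace m s) (x : NZLabel m) :
    frob m 3 (ketA x.1) (comb ketA l) =
      (((2 : ℂ) ^ m) ^ 2 / 2 - 1 - s * ((2 : ℂ) ^ m / 2)) * l x := by
  have h := congrFun (mem_coeffSpace.mp hl).2 x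
  rw [perpOp_apply] at h
  simp only [Pi.smul_apply, smul_eq_mul] at h
  rw [sub_mul, ← h, frob_comb_right]
  have h1 : (((2 : ℂ) ^ m) ^ 2 / 2 - 1) * l x =
      ∑ y : NZLabel m, (((2 : ℂ) ^ m) ^ 2 / 2 - 1) * ((if x = y then 1 else 0) * l y) := by
    simp
  rw [h1, ← Finset.sum_sub_distrib]
  refine Finset.sum_congr rfl fun y _ => ?_
  rw [frob_ketA_ketA x.2 y.2, symp_comm y.1 x.1]
  simp only [Subtype.ext_iff]
  ring

/-- The value is `(N - 2)(N + 1)/2` for `s = 1` and `(N + 2)(N - 1)/2` for `s = -1`; the first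
vanishes at `N = 2`, so `m = 1` must be excluded. -/
theorem gram_factor_ne_zero (hm : 2 ≤ m) {s : ℂ} (hs : s * s = 1) :
    ((2 : ℂ) ^ m) ^ 2 / 2 - 1 - s * ((2 : ℂ) ^ m / 2) ≠ 0 := by
  have hN : (4 : ℕ) ≤ 2 ^ m := by
    calc 4 = 2 ^ 2 := by norm_num
      _ ≤ 2 ^ m := Nat.pow_le_pow_right (by norm_num) hm
  have hcast : (2 : ℂ) ^ m = ((2 ^ m : ℕ) : ℂ) := by push_cast; rfl
  rw [hcast]
  generalize 2 ^ m = N at hN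
  -- With `N = k + 4` the factors become positive natural numbers.
  obtain ⟨k, rfl⟩ : ∃ k, N = k + 4 := ⟨N - 4, by omega⟩
  rcases mul_self_eq_one_iff.mp hs with rfl | rfl
  · have : (((k + 4 : ℕ) : ℂ)) ^ 2 / 2 - 1 - 1 * (((k + 4 : ℕ) : ℂ) / 2) =
        (((k + 2) * (k + 5) : ℕ) : ℂ) / 2 := by push_cast; ring
    rw [this]
    exact div_ne_zero (Nat.cast_ne_zero.mpr (by positivity)) two_ne_zero
  · have : (((k + 4 : ℕ) : ℂ)) ^ 2 / 2 - 1 - -1 * (((k + 4 : ℕ) : ℂ) / 2) =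
        (((k + 6) * (k + 3) : ℕ) : ℂ) / 2 := by push_cast; ring
    rw [this]
    exact div_ne_zero (Nat.cast_ne_zero.mpr (by positivity)) two_ne_zero

theorem comb_ketA_injOn (hm : 2 ≤ m) {s : ℂ} (hs : s * s = 1) :
    ∀ l ∈ coeffSpace m s, comb ketA l = 0 → l = 0 := by
  intro l hl h
  funext x
  have h1 := frob_ketA_comb hl x
  rw [h, map_zero] at h1
  exact (mul_eq_zero.mp h1.symm).resolve_left (gram_factor_ne_zero hm hs)

/-! ### The three constituents -/

/-- For `l = δ_x - δ_y` and a third label `z` orthogonal to `x` but not to `y`, the element `perpOp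
l + (sN/2) l` of `Λ_s` has value one at `z`. Two qubits provide such labels. -/
theorem coeffSpace_ne_bot (hm : 2 ≤ m) {s : ℂ} (hs : s * s = 1) : coeffSpace m s ≠ ⊥ := by
  obtain ⟨k, rfl⟩ : ∃ k, m = k + 2 := ⟨m - 2, by omega⟩
  intro h
  let x : NZLabel (k + 2) := ⟨Pi.single (Sum.inl 0) 1, by simp⟩
  let y : NZLabel (k + 2) := ⟨Pi.single (Sum.inl 1) 1, by simp⟩
  let z : NZLabel (k + 2) := ⟨Pi.single (Sum.inr 1) 1, by simp⟩
  have hzx : z ≠ x := fun e => by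
    simpa [x, z] using congrFun (congrArg Subtype.val e) (Sum.inl 0)
  have hzy : z ≠ y := fun e => by
    simpa [y, z] using congrFun (congrArg Subtype.val e) (Sum.inl 1)
  have hx : symp x.1 z.1 = 0 := by simp [symp, x, z, Pi.single_apply]
  have hy : symp y.1 z.1 = 1 := by simp [symp, y, z, Pi.single_apply]
  let l : NZLabel (k + 2) → ℂ := Pi.single x 1 - Pi.single y 1
  have hl : ∑ u, l u = 0 := by simp [l, Finset.sum_sub_distrib]
  have h1 := perpOp_add_mem_coeffSpace hl hs
  rw [h, Submodule.mem_bot] at h1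
  have h2 := congrFun h1 z
  have hlz : l z = 0 := by simp [l, hzx, hzy]
  have hp : perpOp (k + 2) l z = 1 := by
    simp [perpOp_apply, l, mul_sub, Finset.sum_sub_distrib, Pi.single_apply, hx, hy]
  simp [hlz, hp] at h2

theorem card_nzLabel_ne_zero (hm : 2 ≤ m) : (Fintype.card (NZLabel m) : ℂ) ≠ 0 := by
  have : Nonempty (NZLabel m) := ⟨⟨Pi.single (Sum.inl ⟨0, by omega⟩) 1, by simp⟩⟩
  exact Nat.cast_ne_zero.mpr Fintype.card_ne_zero

theorem span_one_ne_bot (hm : 2 ≤ m) : Submodule.span ℂ {(1 : NZLabel m → ℂ)} ≠ ⊥ := by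
  intro h
  rw [Submodule.span_singleton_eq_bot] at h
  exact card_nzLabel_ne_zero hm (by simpa using congrArg (fun l : NZLabel m → ℂ => ∑ x, l x) h)

/-- The three irreducible constituents of the permutation representation. -/
def coeffPart (m : ℕ) : Fin 3 → Submodule ℂ (NZLabel m → ℂ) :=
  ![Submodule.span ℂ {1}, coeffSpace m 1, coeffSpace m (-1)]

theorem isPermInv_coeffPart (m : ℕ) (i : Fin 3) : IsPermInv (coeffPart m i) := by
  fin_cases i
  · exact isPermInv_span_one m
  · exact isPermInv_coeffSpace m 1
  · exact isPermInv_coeffSpace m (-1)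

theorem isEig_coeffPart (m : ℕ) (i : Fin 3) : IsEig (coeffPart m i) := by
  fin_cases i
  · exact isEig_span_one m
  · exact isEig_coeffSpace m 1
  · exact isEig_coeffSpace m (-1)

theorem coeffPart_ne_bot (hm : 2 ≤ m) (i : Fin 3) : coeffPart m i ≠ ⊥ := by
  fin_cases i
  · exact span_one_ne_bot hm
  · exact coeffSpace_ne_bot hm (by norm_num)
  · exact coeffSpace_ne_bot hm (by norm_num)

/-- The eigenvalues of the orthogonality operator. -/
def perpEigenvalue (m : ℕ) : Fin 3 → ℂ :=
  ![((2 : ℂ) ^ m) ^ 2 / 2 - 1, 1 * ((2 : ℂ) ^ m / 2), -1 * ((2 : ℂ) ^ m / 2)]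

/-- The differences between the eigenvalue on constants and `±N/2` are exactly the Gram factors
already shown to be nonzero. -/
theorem perpEigenvalue_injective (hm : 2 ≤ m) : Function.Injective (perpEigenvalue m) := by
  have h1 := gram_factor_ne_zero hm (s := 1) (by norm_num)
  have h2 := gram_factor_ne_zero hm (s := -1) (by norm_num)
  have h3 := two_pow_ne_zero m
  have h01 : perpEigenvalue m 0 ≠ perpEigenvalue m 1 := fun h => h1 (sub_eq_zero.mpr h)
  have h02 : perpEigenvalue m 0 ≠ perpEigenvalue m 2 := fun h => h2 (sub_eq_zero.mpr h)
  have h12 : perpEigenvalue m 1 ≠ perpEigenvalue m 2 := fun h => h3 (by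
    have h' : 1 * ((2 : ℂ) ^ m / 2) = -1 * ((2 : ℂ) ^ m / 2) := h
    linear_combination h')
  intro i j h
  fin_cases i <;> fin_cases j
  · rfl
  · exact absurd h h01
  · exact absurd h h02
  · exact absurd h.symm h01
  · rfl
  · exact absurd h h12
  · exact absurd h.symm h02
  · exact absurd h.symm h12
  · rfl

theorem coeffPart_le_eigenspace (m : ℕ) (i : Fin 3) :
    coeffPart m i ≤ (perpOp m).eigenspace (perpEigenvalue m i) := by
  intro l hl
  rw [Module.End.mem_eigenspace_iff]
  fin_cases i
  · obtain ⟨c, rfl⟩ := Submodule.mem_span_singleton.mp hl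
    rw [map_smul, perpOp_one, smul_comm]
    rfl
  · exact (mem_coeffSpace.mp hl).2
  · exact (mem_coeffSpace.mp hl).2

theorem iSupIndep_coeffPart (hm : 2 ≤ m) : iSupIndep (coeffPart m) :=
  ((perpOp m).eigenspaces_iSupIndep.comp (perpEigenvalue_injective hm)).mono
    (coeffPart_le_eigenspace m)

theorem iSup_coeffPart (hm : 2 ≤ m) : ⨆ i, coeffPart m i = ⊤ := by
  rw [Submodule.eq_top_iff']
  intro l
  have hN := two_pow_ne_zero m
  have hc := card_nzLabel_ne_zero hm
  set c : ℂ := (∑ x, l x) / Fintype.card (NZLabel m) with hcdef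
  set k : NZLabel m → ℂ := l - c • 1 with hk
  have hk0 : ∑ x, k x = 0 := by
    simp only [hk, Pi.sub_apply, Pi.smul_apply, Pi.one_apply, smul_eq_mul, mul_one,
      Finset.sum_sub_distrib, Finset.sum_const, Finset.card_univ, nsmul_eq_mul, hcdef]
    field_simp
    ring
  have h0 : c • (1 : NZLabel m → ℂ) ∈ ⨆ i, coeffPart m i :=
    Submodule.mem_iSup_of_mem 0 (Submodule.smul_mem _ c (Submodule.mem_span_singleton_self 1))
  have h1 : perpOp m k + (1 * ((2 : ℂ) ^ m / 2)) • k ∈ ⨆ i, coeffPart m i :=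
    Submodule.mem_iSup_of_mem 1 (perpOp_add_mem_coeffSpace hk0 (by norm_num))
  have h2 : perpOp m k + (-1 * ((2 : ℂ) ^ m / 2)) • k ∈ ⨆ i, coeffPart m i :=
    Submodule.mem_iSup_of_mem 2 (perpOp_add_mem_coeffSpace hk0 (by norm_num))
  -- Here `c` is the mean of `l` and `k` the zero-sum remainder; the elements of `Λ_+` and `Λ_-`
  -- built from `k` differ by `N k`.
  have h3 : l = c • 1 + ((2 : ℂ) ^ m)⁻¹ • ((perpOp m k + (1 * ((2 : ℂ) ^ m / 2)) • k) -
      (perpOp m k + (-1 * ((2 : ℂ) ^ m / 2)) • k)) := by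
    have : (perpOp m k + (1 * ((2 : ℂ) ^ m / 2)) • k) -
        (perpOp m k + (-1 * ((2 : ℂ) ^ m / 2)) • k) = (2 : ℂ) ^ m • k := by module
    rw [this, smul_smul, inv_mul_cancel₀ hN, one_smul, hk]
    abel
  rw [h3]
  exact Submodule.add_mem _ h0 (Submodule.smul_mem _ _ (Submodule.sub_mem _ h1 h2))

theorem disjoint_coeffPart (hm : 2 ≤ m) {i j : Fin 3} (hij : i ≠ j) :
    Disjoint (coeffPart m i) (coeffPart m j) :=
  (iSupIndep_coeffPart hm).pairwiseDisjoint hij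

theorem ncVdPart_eq_map (m : ℕ) (i : Fin 3) :
    ncVdPart m i = (coeffPart m i).map (comb fun a => hatKet a 0) := by
  fin_cases i
  · exact sumLine_eq_map fun a : Label m => hatKet a 0
  · exact eigSpan_eq_map 1 fun a : Label m => hatKet a 0
  · exact eigSpan_eq_map (-1) fun a : Label m => hatKet a 0

/-! ### The symmetric noncommuting sector -/

theorem ne_zero_of_symp_eq_one {a b : Label m} (h : symp a b = 1) : a ≠ 0 ∧ b ≠ 0 := by
  constructor
  · rintro rfl; simp at h
  · rintro rfl; simp at h

theorem triKet_add_mem {a b : Label m} (h : symp a b = 1) :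
    triKet a b + triKet a (a + b) ∈ ncSymSpace m := by
  refine Submodule.subset_span ⟨a, b, h, ?_⟩
  rw [triKet, triKet, label_add_cancel]

theorem ncSymSpace_le_of_forall {W : Submodule ℂ (Op m 3)}
    (h : ∀ a b : Label m, symp a b = 1 → triKet a b + triKet a (a + b) ∈ W) :
    ncSymSpace m ≤ W := by
  refine Submodule.span_le.mpr ?_
  rintro _ ⟨a, b, hab, rfl⟩
  have := h a b hab
  rwa [triKet, triKet, label_add_cancel] at this

theorem ncSymSpace_le_ncSpace (m : ℕ) : ncSymSpace m ≤ ncSpace m := by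
  refine ncSymSpace_le_of_forall fun a b h => ?_
  have hne : ∀ {c d : Label m}, symp c d = 1 → triKet c d ∈ ncSpace m := fun {c d} h =>
    Submodule.subset_span
      ⟨c, d, (ne_zero_of_symp_eq_one h).1, (ne_zero_of_symp_eq_one h).2, h, rfl⟩
  exact Submodule.add_mem _ (hne h) (hne (by simp [symp_add_right, h]))

theorem isInv_ncSymSpace (m : ℕ) : IsInv (ncSymSpace m) := fun g =>
  ncSymSpace_le_of_forall fun a b h => by
    rw [Submodule.mem_comap, map_add, adjointRep_triKet, adjointRep_triKet, map_add]
    exact triKet_add_mem (by rw [symp_labelEquiv, h])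

/-- The two cycles turn a generator into four basis vectors, which regroup across the cycles into
one generator with first label `a + b` and one with first label `b`. -/
theorem cycSum_mem_ncSymSpace {X : Op m 3} (hX : X ∈ ncSymSpace m) :
    cycSum m X ∈ ncSymSpace m := by
  suffices h : ncSymSpace m ≤ (ncSymSpace m).comap (cycSum m) from h hX
  refine ncSymSpace_le_of_forall fun a b h => ?_
  have e1 : a + b + a = b := by rw [add_comm, label_add_cancel]
  have h1 := triKet_add_mem (a := a + b) (b := a) (by simp [symp_add_left, symp_comm b a, h])
  have h2 := triKet_add_mem (a := b) (b := a) (by rw [symp_comm, h])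
  rw [e1] at h1
  rw [Submodule.mem_comap, cycSum, LinearMap.add_apply, map_add, map_add, permW_finRotate_triKet,
    permW_finRotate_triKet, permW_finRotate_inv_triKet, permW_finRotate_inv_triKet,
    label_add_cancel]
  convert Submodule.add_mem _ h1 h2 using 1
  rw [add_comm b a]
  abel

theorem projS_mem_ncSymSpace {X : Op m 3} (hX : X ∈ ncSymSpace m) : projS m X ∈ ncSymSpace m :=
  Submodule.smul_mem _ _ (Submodule.add_mem _ hX (cycSum_mem_ncSymSpace hX))

theorem projOne_mem_ncSymSpace {X : Op m 3} (hX : X ∈ ncSymSpace m) :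
    projOne m X ∈ ncSymSpace m :=
  Submodule.smul_mem _ _
    (Submodule.sub_mem _ (Submodule.smul_mem _ _ hX) (cycSum_mem_ncSymSpace hX))

/-- The substitution `h ↦ a + h` preserves the constraint and, since `symp a b = 0`, the signs.
Averaging the two forms of the sum exhibits generators. -/
theorem hatKet_mem_ncSymSpace {a b : Label m} (hab : symp a b = 0) :
    hatKet a b ∈ ncSymSpace m := by
  rw [hatKet_eq]
  refine Submodule.smul_mem _ _ ?_
  have h1 : ∑ h : Label m with symp a h = 1, sgn (symp h b) • triKet a h =
      ∑ h : Label m with symp a h = 1, sgn (symp h b) • triKet a (a + h) := by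
    refine Finset.sum_equiv (Equiv.addLeft a) (fun h => ?_) fun h _ => ?_
    · simp [symp_add_right]
    · simp [symp_add_left, hab, label_add_cancel]
  have h2 : ∑ h : Label m with symp a h = 1, sgn (symp h b) • triKet a h =
      (1 / 2 : ℂ) • ∑ h : Label m with symp a h = 1,
        sgn (symp h b) • (triKet a h + triKet a (a + h)) := by
    simp only [smul_add, Finset.sum_add_distrib, ← h1]
    module
  rw [h2]
  exact Submodule.smul_mem _ _ (Submodule.sum_mem _ fun h hh =>
    Submodule.smul_mem _ _ (triKet_add_mem (Finset.mem_filter.mp hh).2))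

theorem ketA_mem_ncSymSpace (x : Label m) : ketA x ∈ ncSymSpace m :=
  Submodule.sum_mem _ fun _ hh => hatKet_mem_ncSymSpace (Finset.mem_filter.mp hh).2.1

theorem nullVec_mem_ncSymSpace {a b : Label m} (hab : symp a b = 0) :
    nullVec a b ∈ ncSymSpace m :=
  Submodule.add_mem _ (Submodule.add_mem _ (hatKet_mem_ncSymSpace hab)
    (hatKet_mem_ncSymSpace (by simp [symp_add_right, symp_comm b a, hab])))
    (hatKet_mem_ncSymSpace (by simp [symp_add_left, symp_comm b a, hab]))

theorem eigSpan_ketA_le (s : ℂ) : eigSpan s ketA ≤ ncSymSpace m := by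
  refine Submodule.span_le.mpr ?_
  rintro _ ⟨l, -, rfl⟩
  exact Submodule.sum_mem _ fun x _ => Submodule.smul_mem _ _ (ketA_mem_ncSymSpace x.1)

theorem ncFamily_le_ncSymSpace (m : ℕ) (i : Fin 5) : ncFamily m i ≤ ncSymSpace m := by
  fin_cases i
  · refine Submodule.span_le.mpr ?_
    rintro _ ⟨a, -, rfl⟩
    exact hatKet_mem_ncSymSpace (symp_zero_right a)
  · refine Submodule.span_le.mpr ?_
    rintro _ ⟨a, b, -, -, -, hab, rfl⟩
    exact projS_mem_ncSymSpace (nullVec_mem_ncSymSpace hab)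
  · refine Submodule.span_le.mpr ?_
    rintro _ ⟨a, b, -, -, -, hab, rfl⟩
    exact projOne_mem_ncSymSpace (nullVec_mem_ncSymSpace hab)
  · exact eigSpan_ketA_le 1
  · exact eigSpan_ketA_le (-1)

/-! ### Invariance -/

theorem isInv_diagSector (m : ℕ) : IsInv (diagSector m) := by
  rw [diagSector, span_nonzero_eq_map]
  exact isEquivariant_ket₂.isInv_map (isPermInv_top m)

theorem isInv_ncVd (m : ℕ) : IsInv (ncVd m) := by
  rw [ncVd, span_nonzero_eq_map fun a => hatKet a 0]
  exact isEquivariant_hatKet.isInv_map (isPermInv_top m)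

theorem isInv_eigSpan_ketA (s : ℂ) : IsInv (eigSpan s (ketA : Label m → Op m 3)) := by
  rw [eigSpan_eq_map]
  exact isEquivariant_ketA.isInv_map (isPermInv_coeffSpace m s)

theorem adjointRep_nullVec (g : cliffordGroup m) (a b : Label m) :
    adjointRep m 3 g (nullVec a b) = nullVec (labelEquiv g a) (labelEquiv g b) := by
  simp only [nullVec, map_add, adjointRep_hatKet]

theorem isInv_ncNull {P : Op m 3 →ₗ[ℂ] Op m 3}
    (hP : ∀ g X, adjointRep m 3 g (P X) = P (adjointRep m 3 g X)) : IsInv (ncNull P) := by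
  intro g
  refine Submodule.span_le.mpr ?_
  rintro _ ⟨a, b, ha, hb, hne, hab, rfl⟩
  refine Submodule.subset_span ⟨labelEquiv g a, labelEquiv g b, by simpa using ha,
    by simpa using hb, by simpa using hne, by rw [symp_labelEquiv, hab], ?_⟩
  rw [hP]
  exact congrArg P (adjointRep_nullVec g a b)

theorem isInv_ncFamily (m : ℕ) (i : Fin 5) : IsInv (ncFamily m i) := by
  fin_cases i
  · exact isInv_ncVd m
  · exact isInv_ncNull adjointRep_projS
  · exact isInv_ncNull adjointRep_projOne
  · exact isInv_eigSpan_ketA 1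
  · exact isInv_eigSpan_ketA (-1)

theorem isInv_ncRest (m : ℕ) : IsInv (ncRest m) := by
  have hsup : IsInv (⨆ i, ncFamily m i) := fun g => iSup_le fun i X hX =>
    Submodule.mem_iSup_of_mem i (isInv_ncFamily m i g hX)
  rintro g X ⟨hX1, hX2⟩
  refine ⟨isInv_ncSymSpace m g hX1, ?_⟩
  rw [SetLike.mem_coe, Submodule.mem_orthogonalBilin_iff] at hX2 ⊢
  intro Y hY
  -- By unitarity `g` passes to the other argument as `g⁻¹`, which preserves the sum of the five
  -- subspaces.
  have h : frob m 3 (adjointRep m 3 g⁻¹ Y) X = 0 := hX2 _ (hsup g⁻¹ hY)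
  rw [← frob_adjointRep g] at h
  rwa [← Module.End.mul_apply, ← map_mul, mul_inv_cancel, map_one] at h

/-! ### Orthogonality -/

theorem frob_eq_zero_of_span {t : ℕ} {s s' : Set (Op m t)}
    (h : ∀ X ∈ s, ∀ Y ∈ s', frob m t X Y = 0) :
    ∀ X ∈ Submodule.span ℂ s, ∀ Y ∈ Submodule.span ℂ s', frob m t X Y = 0 := by
  intro X hX Y hY
  induction hX using Submodule.span_induction with
  | mem X hX =>
    induction hY using Submodule.span_induction with
    | mem Y hY => exact h X hX Y hY
    | zero => simp
    | add Y Y' _ _ h1 h2 => rw [map_add, h1, h2, add_zero]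
    | smul c Y _ h1 => rw [map_smul, h1, smul_zero]
  | zero => simp
  | add X X' _ _ h1 h2 => rw [map_add, LinearMap.add_apply, h1, h2, add_zero]
  | smul c X _ h1 => rw [LinearMap.map_smulₛₗ₂, h1, smul_zero]

theorem frob_eq_zero_symm {t : ℕ} {X Y : Op m t} (h : frob m t X Y = 0) : frob m t Y X = 0 := by
  rw [← frob_conj_symm, h, map_zero]

theorem frob_projS_eq_zero {X Y : Op m 3} (h : frob m 3 X Y = 0)
    (h' : frob m 3 X (cycSum m Y) = 0) : frob m 3 X (projS m Y) = 0 := by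
  simp [projS, h, h']

theorem frob_projOne_eq_zero {X Y : Op m 3} (h : frob m 3 X Y = 0)
    (h' : frob m 3 X (cycSum m Y) = 0) : frob m 3 X (projOne m Y) = 0 := by
  simp [projOne, h, h']

theorem frob_sum_ketA_eq_zero {X : Op m 3} (h : ∀ x : Label m, x ≠ 0 → frob m 3 (ketA x) X = 0)
    (l : NZLabel m → ℂ) : frob m 3 (∑ x, l x • ketA x.1) X = 0 := by
  rw [map_sum, LinearMap.sum_apply]
  exact Finset.sum_eq_zero fun x _ => by rw [LinearMap.map_smulₛₗ₂, h x.1 x.2, smul_zero]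

/-- `perpOp` is a real symmetric matrix, so eigenvectors for the distinct real eigenvalues `N/2` and
`-N/2` are orthogonal. -/
theorem sum_star_mul_eq_zero {l k : NZLabel m → ℂ} (hl : l ∈ coeffSpace m 1)
    (hk : k ∈ coeffSpace m (-1)) : ∑ x, (starRingEnd ℂ) (l x) * k x = 0 := by
  have h1 : ∑ x, (starRingEnd ℂ) (perpOp m l x) * k x =
      ∑ x, (starRingEnd ℂ) (l x) * perpOp m k x := by
    simp only [perpOp_apply, map_sum, map_mul, Finset.sum_mul, Finset.mul_sum]
    rw [Finset.sum_comm]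
    refine Finset.sum_congr rfl fun x _ => Finset.sum_congr rfl fun y _ => ?_
    rw [symp_comm y.1 x.1]
    split_ifs <;> simp
  rw [(mem_coeffSpace.mp hl).2, (mem_coeffSpace.mp hk).2] at h1
  simp only [Pi.smul_apply, smul_eq_mul, map_mul, map_one, map_div₀, map_pow,
    Complex.conj_ofNat] at h1
  have h2 : (2 : ℂ) ^ m * ∑ x, (starRingEnd ℂ) (l x) * k x = 0 := by
    rw [← sub_eq_zero, ← Finset.sum_sub_distrib] at h1
    rw [← h1, Finset.mul_sum]
    exact Finset.sum_congr rfl fun x _ => by ring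
  exact (mul_eq_zero.mp h2).resolve_left (two_pow_ne_zero m)

theorem frob_comb_ketA_eq_zero {l k : NZLabel m → ℂ} (hl : l ∈ coeffSpace m 1)
    (hk : k ∈ coeffSpace m (-1)) : frob m 3 (comb ketA l) (comb ketA k) = 0 := by
  rw [comb_apply ketA l, map_sum, LinearMap.sum_apply]
  simp only [LinearMap.map_smulₛₗ₂, frob_ketA_comb hk, smul_eq_mul]
  have h := congrArg (fun z => (((2 : ℂ) ^ m) ^ 2 / 2 - 1 - -1 * ((2 : ℂ) ^ m / 2)) * z)
    (sum_star_mul_eq_zero hl hk)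
  simp only [mul_zero, Finset.mul_sum] at h
  rw [← h]
  exact Finset.sum_congr rfl fun x _ => by ring

/-- Conjugate symmetry of the form makes ordered pairs sufficient. The auxiliary statements take an
abstract `P` that preserves orthogonality to a vector and its cyclic sum, and so cover both null
subspaces at once. -/
theorem ncFamily_orthogonal_of_lt {i j : Fin 5} (hij : i < j) :
    ∀ X ∈ ncFamily m i, ∀ Y ∈ ncFamily m j, frob m 3 X Y = 0 := by
  have hd_null : ∀ {P : Op m 3 →ₗ[ℂ] Op m 3}, (∀ X Y, frob m 3 X Y = 0 →
      frob m 3 X (cycSum m Y) = 0 → frob m 3 X (P Y) = 0) →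
      ∀ X ∈ ncVd m, ∀ Y ∈ ncNull P, frob m 3 X Y = 0 := by
    intro P hP
    refine frob_eq_zero_of_span ?_
    rintro _ ⟨c, -, rfl⟩ _ ⟨a, b, ha, hb, hne, hab, rfl⟩
    exact hP _ (nullVec a b) (frob_hatKet_zero_nullVec c ha hb hne)
      (frob_hatKet_zero_cycSum_nullVec c hab)
  have hd_A : ∀ s : ℂ, ∀ X ∈ ncVd m, ∀ Y ∈ eigSpan s ketA, frob m 3 X Y = 0 := by
    intro s
    refine frob_eq_zero_of_span ?_
    rintro _ ⟨c, -, rfl⟩ _ ⟨l, -, rfl⟩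
    exact frob_eq_zero_symm (frob_sum_ketA_eq_zero (fun x hx => frob_hatKet_zero_ketA hx) l)
  have hnull_A : ∀ {P : Op m 3 →ₗ[ℂ] Op m 3}, (∀ X Y, frob m 3 X Y = 0 →
      frob m 3 X (cycSum m Y) = 0 → frob m 3 X (P Y) = 0) →
      ∀ s : ℂ, ∀ X ∈ ncNull P, ∀ Y ∈ eigSpan s ketA, frob m 3 X Y = 0 := by
    intro P hP s
    refine frob_eq_zero_of_span ?_
    rintro _ ⟨a, b, ha, hb, hne, hab, rfl⟩ _ ⟨l, -, rfl⟩
    exact frob_eq_zero_symm (frob_sum_ketA_eq_zero (fun x _ => hP _ (nullVec a b)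
      (frob_ketA_nullVec x ha hb hne hab) (frob_ketA_cycSum_nullVec x ha hb hne hab)) l)
  have hnull : ∀ X ∈ ncNullS m, ∀ Y ∈ ncNullOne m, frob m 3 X Y = 0 := by
    refine frob_eq_zero_of_span ?_
    rintro _ ⟨a, b, -, -, -, -, rfl⟩ _ ⟨a', b', -, -, -, -, rfl⟩
    rw [frob_projS_left, ← Module.End.mul_apply, projS_mul_projOne, LinearMap.zero_apply, map_zero]
  have hA : ∀ X ∈ ncV₁ m, ∀ Y ∈ ncV₂ m, frob m 3 X Y = 0 := by
    refine frob_eq_zero_of_span ?_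
    rintro _ ⟨l, hl, rfl⟩ _ ⟨k, hk, rfl⟩
    exact frob_comb_ketA_eq_zero hl hk
  have hS := fun X Y : Op m 3 => frob_projS_eq_zero (X := X) (Y := Y)
  have hO := fun X Y : Op m 3 => frob_projOne_eq_zero (X := X) (Y := Y)
  fin_cases i <;> fin_cases j <;> first | exact absurd hij (by decide) | skip
  · exact hd_null hS
  · exact hd_null hO
  · exact hd_A 1
  · exact hd_A (-1)
  · exact hnull
  · exact hnull_A hS 1
  · exact hnull_A hS (-1)
  · exact hnull_A hO 1
  · exact hnull_A hO (-1)
  · exact hA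

theorem ncFamily_orthogonal {i j : Fin 5} (hij : i ≠ j) :
    ∀ X ∈ ncFamily m i, ∀ Y ∈ ncFamily m j, frob m 3 X Y = 0 := by
  intro X hX Y hY
  rcases lt_or_gt_of_ne hij with h | h
  · exact ncFamily_orthogonal_of_lt h X hX Y hY
  · exact frob_eq_zero_symm (ncFamily_orthogonal_of_lt h Y hY X hX)

/-! ### The diagonal sector -/

theorem comb_single {t : ℕ} (v : Label m → Op m t) (x : NZLabel m) :
    comb v (Pi.single x 1) = v x.1 := by
  simp [comb]

/-- Both subspaces are copies of the full permutation representation; passing through it matches `v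
x` with `w x`, since both are images of the delta function at `x`. -/
theorem exists_equiv_of_eq_map {t t' : ℕ} {v : Label m → Op m t} {w : Label m → Op m t'}
    (hv : IsEquivariant v) (hw : IsEquivariant w) (hinjv : ∀ l, comb v l = 0 → l = 0)
    (hinjw : ∀ l, comb w l = 0 → l = 0) {V : Submodule ℂ (Op m t)} {W : Submodule ℂ (Op m t')}
    (hV : V = (⊤ : Submodule ℂ (NZLabel m → ℂ)).map (comb v))
    (hW : W = (⊤ : Submodule ℂ (NZLabel m → ℂ)).map (comb w)) (iV : IsInv V) (iW : IsInv W) :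
    ∃ L : (subrep iV).Equiv (subrep iW), ∀ (x : NZLabel m) (hx : v x.1 ∈ V),
      (L ⟨v x.1, hx⟩ : Op m t') = w x.1 := by
  subst hV hW
  let e := combEquiv hv (isPermInv_top m) fun l _ => hinjv l
  let f := combEquiv hw (isPermInv_top m) fun l _ => hinjw l
  refine ⟨e.symm.trans f, fun x hx => ?_⟩
  have h1 : e ⟨Pi.single x 1, trivial⟩ = ⟨v x.1, hx⟩ := Subtype.ext (comb_single v x)
  have h2 : (e.symm.trans f) ⟨v x.1, hx⟩ = f ⟨Pi.single x 1, trivial⟩ := by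
    rw [← h1, Representation.Equiv.trans_apply, Representation.Equiv.symm_apply_apply]
  rw [h2]
  exact comb_single w x

theorem exists_diagSector_equiv (m : ℕ) :
    ∃ (hD : IsInv (diagSector m)) (hd : IsInv (ncVd m)) (L : (subrep hD).Equiv (subrep hd)),
      ∀ (a : Label m) (ha : a ≠ 0),
        (L ⟨ket₂ a, Submodule.subset_span ⟨a, ha, rfl⟩⟩ : Op m 3) = hatKet a 0 := by
  obtain ⟨L, hL⟩ := exists_equiv_of_eq_map isEquivariant_ket₂ isEquivariant_hatKet
    comb_ket₂_injective comb_hatKet_injective (span_nonzero_eq_map ket₂)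
    (span_nonzero_eq_map fun a => hatKet a 0) (isInv_diagSector m) (isInv_ncVd m)
  exact ⟨_, _, L, fun a ha => hL ⟨a, ha⟩ _⟩

theorem ncVdPart_decomposition (hm : 2 ≤ m) :
    (∀ i, CarriesIrrep (ncVdPart m i)) ∧
      (∀ i j, i ≠ j → ¬ EquivalentReps (ncVdPart m i) (ncVdPart m j)) ∧
      iSupIndep (ncVdPart m) ∧ ⨆ i, ncVdPart m i = ncVd m := by
  have h : ncVdPart m = fun i => (coeffPart m i).map (comb fun a => hatKet a 0) :=
    funext (ncVdPart_eq_map m)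
  rw [h]
  refine ⟨fun i => carriesIrrep_map isEquivariant_hatKet (isEig_coeffPart m i)
      (isPermInv_coeffPart m i) (coeffPart_ne_bot hm i) fun l _ => comb_hatKet_injective l,
    fun i j hij => not_equivalentReps_map isEquivariant_hatKet (isEig_coeffPart m i)
      (isPermInv_coeffPart m i) (isPermInv_coeffPart m j) (coeffPart_ne_bot hm i)
      (disjoint_coeffPart hm hij) comb_hatKet_injective, ?_, ?_⟩
  · exact LinearMap.iSupIndep_map _
      ((injective_iff_map_eq_zero _).mpr comb_hatKet_injective) (iSupIndep_coeffPart hm)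
  · rw [← Submodule.map_iSup, iSup_coeffPart hm]
    exact (span_nonzero_eq_map fun a => hatKet a 0).symm

theorem equivalentReps_eigSpan (hm : 2 ≤ m) {s : ℂ} (hs : s * s = 1) :
    EquivalentReps (eigSpan s (ketA : Label m → Op m 3)) (eigSpan s (ket₂ : Label m → Op m 2)) := by
  rw [eigSpan_eq_map, eigSpan_eq_map]
  exact equivalentReps_map isEquivariant_ketA isEquivariant_ket₂ (isPermInv_coeffSpace m s)
    (comb_ketA_injOn hm hs) fun l _ => comb_ket₂_injective l

end

end CliffordCopies

theorem theorem3 (m : ℕ) :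
    -- the basis vectors, the operators `W_σ`, the projectors and the vectors `|â;b⟩`
    ((∀ a b : Fin 3 → Label m, frob m 3 (ket₃ a) (ket₃ b) = if a = b then 1 else 0) ∧
      (∀ (σ : Equiv.Perm (Fin 3)) (a : Fin 3 → Label m),
        permW m σ (ket₃ a) = ket₃ (a ∘ ⇑σ⁻¹)) ∧
      (IsIdempotentElem (projS m) ∧
        ∀ X Y, frob m 3 (projS m X) Y = frob m 3 X (projS m Y)) ∧
      (IsIdempotentElem (projOne m) ∧
        ∀ X Y, frob m 3 (projOne m X) Y = frob m 3 X (projOne m Y)) ∧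
      (∀ a b : Label m, a ≠ 0 → symp a b = 0 → hatKet a b = -hatKet a (a + b))) ∧
    -- the location of all the subspaces
    (ncSymSpace m ≤ ncSpace m ∧ ∀ i, ncFamily m i ≤ ncSymSpace m) ∧
    -- (i) the diagonal sector and its three irreducible representations
    ((∃ (hD : IsInv (diagSector m)) (hd : IsInv (ncVd m))
        (L : (subrep hD).Equiv (subrep hd)),
        ∀ (a : Label m) (ha : a ≠ 0),
          (L ⟨ket₂ a, Submodule.subset_span ⟨a, ha, rfl⟩⟩ : Op m 3) = hatKet a 0) ∧
      (2 ≤ m →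
        (∀ i, CarriesIrrep (ncVdPart m i)) ∧
        (∀ i j, i ≠ j → ¬ EquivalentReps (ncVdPart m i) (ncVdPart m j)) ∧
        iSupIndep (ncVdPart m) ∧ ⨆ i, ncVdPart m i = ncVd m)) ∧
    -- (ii) the subspaces equivalent to `V₁` and `V₂`
    (IsInv (ncV₁ m) ∧ IsInv (ncV₂ m) ∧
      (2 ≤ m → EquivalentReps (ncV₁ m) (diagV₁ m) ∧ EquivalentReps (ncV₂ m) (diagV₂ m))) ∧
    -- (iii), (iv) the null subspaces
    IsInv (ncNullS m) ∧
    IsInv (ncNullOne m) ∧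
    -- (v) the sum is orthogonal and the remaining complement is invariant
    ((∀ i j, i ≠ j → ∀ X ∈ ncFamily m i, ∀ Y ∈ ncFamily m j, frob m 3 X Y = 0) ∧
      IsInv (ncRest m)) := by
  exact ⟨⟨frob_ket₃, permW_ket₃, ⟨isIdempotentElem_projS m, frob_projS_left⟩,
      ⟨isIdempotentElem_projOne m, frob_projOne_left⟩, fun a b _ _ => hatKet_eq_neg a b⟩,
    ⟨ncSymSpace_le_ncSpace m, ncFamily_le_ncSymSpace m⟩,
    ⟨exists_diagSector_equiv m, ncVdPart_decomposition⟩,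
    ⟨isInv_eigSpan_ketA 1, isInv_eigSpan_ketA (-1), fun hm =>
      ⟨equivalentReps_eigSpan hm (by norm_num), equivalentReps_eigSpan hm (by norm_num)⟩⟩,
    isInv_ncNull adjointRep_projS, isInv_ncNull adjointRep_projOne,
    fun _ _ => ncFamily_orthogonal, isInv_ncRest m⟩
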